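/- **Theorem.** Let $1\to\mathbb T\to\widehat\Gamma\xrightarrow{q}\Gamma\to 1$ be a central extension of Lie groups by the unit circle $\mathbb T$, where $q$ is a smooth principal $\mathbb T$-bundle (manifolds are smooth and modelled on real normed spaces, so finite-dimensional manifolds are included). Let $0\to i\mathbb R\to \mathrm{Lie}\,\widehat\Gamma\xrightarrow{q_*}\mathrm{Lie}\,\Gamma\to 0$ be the induced central extension of Lie algebras, with $i\mathbb R=\mathrm{Lie}\,\mathbb T$, and let $\sigma:\mathrm{Lie}\,\Gamma\to\mathrm{Lie}\,\widehat\Gamma$ be a split of it, that is, a (continuous) linear map with $q_*\circ\sigma=\mathrm{id}$. Let $\Gamma$ act on $\mathrm{Lie}\,\widehat\Gamma$ by $\mathrm{Ad}_\gamma=\mathrm{Ad}_{\hat\gamma}$ for any $\hat\gamma\in\widehat\Gamma$ with $q(\hat\gamma)=\gamma$, and put $$Z_\sigma(\gamma,A)=\mathrm{Ad}_\gamma\sigma(A)-\sigma(\mathrm{Ad}_\gamma A),\qquad \nu_\sigma=\hat\mu-\sigma(q^*\mu),$$ where $\hat\mu$ and $\mu$ are the left Maurer–Cartan forms of $\widehat\Gamma$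 and $\Gamma$. Let $\pi:B\to X$ be a smooth principal $\Gamma$-bundle with a connection $\theta\in\Omega^1(B;\mathrm{Lie}\,\Gamma)$. Put $B^{[2]}=B\times_XB$, with projections $\pi_1,\pi_2:B^{[2]}\to B$, define $\zeta:B^{[2]}\to\Gamma$ by $b_1\,\zeta(b_1,b_2)=b_2$, and let $\rho:J_B=\zeta^*\widehat\Gamma\to B^{[2]}$ be the pull-back of the $\mathbb T$-bundle $\widehat\Gamma\to\Gamma$, with the product $m:\pi_{12}^*J_B\otimes\pi_{23}^*J_B\to\pi_{13}^*J_B$ over $B^{[3]}$ induced by the multiplication of $\widehat\Gamma$. The pair $(J_B,B)$ with this product is a bundle gerbe over $X$, the lifting bundle gerbe: $\pi$ is locally split, $J_B\to B^{[2]}$ is a principal $\mathbb T$-bundle and $m$ is a smooth associative isomorphism of $\mathbb T$-bundles. Then the $1$-form $$\nabla_{\theta,\sigma}=\zeta^*\nu_\sigma+\rho^*Z_\sigma(\zeta^{-1},\pi_1^*\theta)$$ on $J_B$ takes values in $i\mathbb R$ (here $\zeta^*\nu_\sigma$ is the pull-back of $\nu_\sigma$ under the canonical map $J_B=\zeta^*\widehat\Gamma\to\widehat\Gamma$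 covering $\zeta$), and it is a bundle gerbe connection on $(J_B,B)$: it is a smooth principal connection on the $\mathbb T$-bundle $J_B\to B^{[2]}$, and it is compatible with the product, $\pi_{12}^*\nabla_{\theta,\sigma}+\pi_{23}^*\nabla_{\theta,\sigma}=m^*\pi_{13}^*\nabla_{\theta,\sigma}$. -/

import Mathlib

open scoped Manifold ContDiff
open Bundle

noncomputable section

/-! ### Transporting a manifold structure along a homeomorphism -/

section Transport

variable {E H M N : Type*} [NormedAddCommGroup E] [NormedSpace ℝ E] [TopologicalSpace H]
  [TopologicalSpace M] [ChartedSpace H M] [TopologicalSpace N]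

/-- The charted space structure on `N` whose charts are the charts of `M` composed with the
homeomorphism `h : N ≃ₜ M`. -/
abbrev transportChartedSpace (h : N ≃ₜ M) : ChartedSpace H N where
  atlas := (fun c => h.toOpenPartialHomeomorph.trans c) '' atlas H M
  chartAt x := h.toOpenPartialHomeomorph.trans (chartAt H (h x))
  mem_chart_source x := by simp
  chart_mem_atlas x := ⟨_, chart_mem_atlas H (h x), rfl⟩

theorem transport_isManifold (I : ModelWithCorners ℝ E H) (h : N ≃ₜ M) [IsManifold I ∞ M] :
    @IsManifold ℝ _ E _ _ H _ I ∞ N _ (transportChartedSpace h) := by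
  let _ := transportChartedSpace (H := H) h
  refine @IsManifold.mk ℝ _ E _ _ H _ I ∞ N _ _ ⟨?_⟩
  rintro _ _ ⟨c, hc, rfl⟩ ⟨c', hc', rfl⟩
  have hcc := (contDiffGroupoid ∞ I).compatible hc hc'
  refine (contDiffGroupoid ∞ I).mem_of_eqOnSource hcc ?_
  constructor
  · ext x
    simp
  · intro x hx
    simp

theorem transport_contMDiff (I : ModelWithCorners ℝ E H) (h : N ≃ₜ M) [IsManifold I ∞ M] :
    letI := transportChartedSpace (H := H) h
    ContMDiff I I ∞ h ∧ ContMDiff I I ∞ h.symm := by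
  let _ := transportChartedSpace (H := H) h
  have hc : ∀ x : N, chartAt H x = h.toOpenPartialHomeomorph.trans (chartAt H (h x)) :=
    fun _ => rfl
  constructor
  · intro x
    rw [contMDiffAt_iff]
    refine ⟨h.continuous.continuousAt, ?_⟩
    have := (contMDiffAt_iff.1 (contMDiff_id (I := I) (n := ∞) (M := M) (h x))).2
    have e : (extChartAt I (h x) ∘ h ∘ (extChartAt I x).symm) =
        extChartAt I (id (h x)) ∘ id ∘ (extChartAt I (h x)).symm := by
      ext y; simp [extChartAt, hc]
    rw [e]
    simpa [extChartAt, hc] using this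
  · intro y
    rw [contMDiffAt_iff]
    refine ⟨h.symm.continuous.continuousAt, ?_⟩
    have := (contMDiffAt_iff.1 (contMDiff_id (I := I) (n := ∞) (M := M) y)).2
    have e : (extChartAt I (h.symm y) ∘ h.symm ∘ (extChartAt I y).symm) =
        extChartAt I (id y) ∘ id ∘ (extChartAt I y).symm := by
      ext y; simp [extChartAt, hc]
    rw [e]
    simpa using this

end Transport

/-! ### Principal bundles and central extensions -/

section Bundles

variable {EG HG G EP HP P EX HX X : Type*}
  [NormedAddCommGroup EG] [NormedSpace ℝ EG] [TopologicalSpace HG]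
  [TopologicalSpace G] [ChartedSpace HG G] [Group G]
  [NormedAddCommGroup EP] [NormedSpace ℝ EP] [TopologicalSpace HP]
  [TopologicalSpace P] [ChartedSpace HP P]
  [NormedAddCommGroup EX] [NormedSpace ℝ EX] [TopologicalSpace HX]
  [TopologicalSpace X] [ChartedSpace HX X]

/-- `proj : P → X` with the right action `act` of the Lie group `G` is a smooth principal
`G`-bundle: near every point of `X` there is a smooth `G`-equivariant trivialization. -/
structure IsPrincipalBundle (IG : ModelWithCorners ℝ EG HG) (IP : ModelWithCorners ℝ EP HP)
    (IX : ModelWithCorners ℝ EX HX) (proj : P → X) (act : P → G → P) : Prop where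
  smooth_proj : ContMDiff IP IX ∞ proj
  smooth_act : ContMDiff (IP.prod IG) IP ∞ (fun x : P × G => act x.1 x.2)
  act_one : ∀ p, act p 1 = p
  act_mul : ∀ p g h, act p (g * h) = act (act p g) h
  proj_act : ∀ p g, proj (act p g) = proj p
  locally_trivial : ∀ x : X, ∃ e : Trivialization G proj, x ∈ e.baseSet ∧
    ContMDiffOn IP (IX.prod IG) ∞ e e.source ∧
    ContMDiffOn (IX.prod IG) IP ∞ e.toOpenPartialHomeomorph.symm e.target ∧
    ∀ p ∈ e.source, ∀ g, e (act p g) = ((e p).1, (e p).2 * g)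

/-- A smooth principal `G`-bundle `proj : P → X`. -/
structure PrincipalBundle (IG : ModelWithCorners ℝ EG HG) (IP : ModelWithCorners ℝ EP HP)
    (IX : ModelWithCorners ℝ EX HX) (G P X : Type*)
    [TopologicalSpace G] [ChartedSpace HG G] [Group G] [TopologicalSpace P] [ChartedSpace HP P]
    [TopologicalSpace X] [ChartedSpace HX X] where
  proj : P → X
  act : P → G → P
  isPrincipalBundle : IsPrincipalBundle IG IP IX proj act

namespace IsPrincipalBundle

variable {IG : ModelWithCorners ℝ EG HG} {IP : ModelWithCorners ℝ EP HP}
  {IX : ModelWithCorners ℝ EX HX} {proj : P → X} {act : P → G → P}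

theorem existsUnique_translate (h : IsPrincipalBundle IG IP IX proj act) {b c : P}
    (hbc : proj b = proj c) : ∃! g : G, act b g = c := by
  obtain ⟨e, he, -, -, heq⟩ := h.locally_trivial (proj b)
  have hb : b ∈ e.source := e.mem_source.2 he
  have hc : c ∈ e.source := e.mem_source.2 (hbc ▸ he)
  refine ⟨(e b).2⁻¹ * (e c).2, ?_, ?_⟩
  · have hbg : act b ((e b).2⁻¹ * (e c).2) ∈ e.source :=
      e.mem_source.2 (by rw [h.proj_act]; exact he)
    refine e.injOn hbg hc ?_
    change e (act b _) = e c
    rw [heq b hb]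
    refine Prod.ext ?_ ?_
    · change (e b).1 = (e c).1
      rw [e.coe_fst hb, e.coe_fst hc, hbc]
    · simp
  · rintro g rfl
    rw [heq b hb]
    simp

/-- The unique element of the structure group that carries `b` to `c`. -/
def translate (h : IsPrincipalBundle IG IP IX proj act) (b c : P) (hbc : proj b = proj c) : G :=
  (h.existsUnique_translate hbc).choose

theorem act_translate (h : IsPrincipalBundle IG IP IX proj act) {b c : P}
    (hbc : proj b = proj c) : act b (h.translate b c hbc) = c :=
  (h.existsUnique_translate hbc).choose_spec.1

theorem eq_translate (h : IsPrincipalBundle IG IP IX proj act) {b c : P}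
    (hbc : proj b = proj c) {g : G} (hg : act b g = c) : h.translate b c hbc = g :=
  (h.existsUnique_translate hbc).unique (h.act_translate hbc) hg

theorem translate_eq (h : IsPrincipalBundle IG IP IX proj act) {b c : P}
    (hbc : proj b = proj c) (e : Trivialization G proj) (hb : b ∈ e.source)
    (heq : ∀ p ∈ e.source, ∀ g, e (act p g) = ((e p).1, (e p).2 * g)) :
    h.translate b c hbc = (e b).2⁻¹ * (e c).2 := by
  have := heq b hb (h.translate b c hbc)
  rw [h.act_translate] at this
  rw [this]
  simp

theorem continuous_translate [IsTopologicalGroup G] (h : IsPrincipalBundle IG IP IX proj act)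
    {N : Type*} [TopologicalSpace N] {f g : N → P} (hf : Continuous f) (hg : Continuous g)
    (hfg : ∀ x, proj (f x) = proj (g x)) :
    Continuous fun x => h.translate (f x) (g x) (hfg x) := by
  rw [continuous_iff_continuousAt]
  intro x
  obtain ⟨e, he, -, -, heq⟩ := h.locally_trivial (proj (f x))
  have hfx : f x ∈ e.source := e.mem_source.2 he
  have hgx : g x ∈ e.source := e.mem_source.2 (hfg x ▸ he)
  have h1 : ContinuousAt (fun y => (e (f y)).2⁻¹ * (e (g y)).2) x :=
    (((e.continuousAt hfx).comp hf.continuousAt).snd.inv).mul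
      ((e.continuousAt hgx).comp hg.continuousAt).snd
  refine h1.congr ?_
  filter_upwards [hf.continuousAt.preimage_mem_nhds (e.open_source.mem_nhds hfx)] with y hy
  exact (h.translate_eq (hfg y) e hy heq).symm

theorem contMDiff_translate [LieGroup IG ∞ G] (h : IsPrincipalBundle IG IP IX proj act)
    {EN HN N : Type*} [NormedAddCommGroup EN] [NormedSpace ℝ EN] [TopologicalSpace HN]
    [TopologicalSpace N] [ChartedSpace HN N] {IN : ModelWithCorners ℝ EN HN}
    {f g : N → P} (hf : ContMDiff IN IP ∞ f) (hg : ContMDiff IN IP ∞ g)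
    (hfg : ∀ x, proj (f x) = proj (g x)) :
    ContMDiff IN IG ∞ fun x => h.translate (f x) (g x) (hfg x) := by
  intro x
  obtain ⟨e, he, hs, -, heq⟩ := h.locally_trivial (proj (f x))
  have hfx : f x ∈ e.source := e.mem_source.2 he
  have hgx : g x ∈ e.source := e.mem_source.2 (hfg x ▸ he)
  have hs' : ∀ p ∈ e.source, ContMDiffAt IP IG ∞ (fun p => (e p).2) p := fun p hp =>
    (hs.contMDiffAt (e.open_source.mem_nhds hp)).snd
  have h1 : ContMDiffAt IN IG ∞ (fun y => (e (f y)).2⁻¹ * (e (g y)).2) x :=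
    (((hs' _ hfx).comp x (hf x)).inv).mul ((hs' _ hgx).comp x (hg x))
  refine h1.congr_of_eventuallyEq ?_
  filter_upwards [hf.continuous.continuousAt.preimage_mem_nhds
    (e.open_source.mem_nhds hfx)] with y hy
  exact h.translate_eq (hfg y) e hy heq

end IsPrincipalBundle

end Bundles

/-! ### Lie algebra valued one-forms and connections -/

section Forms

variable {EG HG G EK HK K EM HM M EN HN N : Type*}
  [NormedAddCommGroup EG] [NormedSpace ℝ EG] [TopologicalSpace HG]
  [TopologicalSpace G] [ChartedSpace HG G] [Group G]
  [NormedAddCommGroup EK] [NormedSpace ℝ EK] [TopologicalSpace HK]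
  [TopologicalSpace K] [ChartedSpace HK K] [Group K]
  [NormedAddCommGroup EM] [NormedSpace ℝ EM] [TopologicalSpace HM]
  [TopologicalSpace M] [ChartedSpace HM M]
  [NormedAddCommGroup EN] [NormedSpace ℝ EN] [TopologicalSpace HN]
  [TopologicalSpace N] [ChartedSpace HN N]

/-- (Not necessarily smooth) one-forms on `M` with values in the Lie algebra of `G`. -/
abbrev LieForm (IM : ModelWithCorners ℝ EM HM) (M : Type*) [TopologicalSpace M]
    [ChartedSpace HM M] (IG : ModelWithCorners ℝ EG HG) (G : Type*) [TopologicalSpace G]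
    [ChartedSpace HG G] [Group G] :=
  ∀ x : M, TangentSpace IM x →L[ℝ] GroupLieAlgebra IG G

variable {IM : ModelWithCorners ℝ EM HM} {IN : ModelWithCorners ℝ EN HN}
  {IG : ModelWithCorners ℝ EG HG} {IK : ModelWithCorners ℝ EK HK}

/-- A one-form is smooth if it is smooth as a function on the tangent bundle. (The Lie algebra of
`G` is the tangent space at `1`, which Mathlib defines as the normed model space `EG`.) -/
def LieForm.IsSmooth [IsManifold IM 1 M] (α : LieForm IM M IG G) : Prop :=
  ContMDiff (M' := EG) IM.tangent 𝓘(ℝ, EG) ∞ (fun v : TangentBundle IM M => α v.1 v.2)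

/-- The pull-back of a one-form under a map. -/
def LieForm.pullback (f : N → M) (α : LieForm IM M IG G) : LieForm IN N IG G :=
  fun x => (α (f x)).comp (mfderiv IN IM f x)

variable (IG IK) in
/-- The linear map between Lie algebras induced by a homomorphism (its derivative at `1`). -/
def lieMap (f : G →* K) : GroupLieAlgebra IG G →L[ℝ] GroupLieAlgebra IK K :=
  mfderiv IG IK f 1

variable (IG) in
/-- The adjoint action: the derivative at `1` of the conjugation `x ↦ g * x * g⁻¹`, which maps
`1` to `1`. -/
def lieAd (g : G) : GroupLieAlgebra IG G →L[ℝ] GroupLieAlgebra IG G :=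
  mfderiv IG IG (fun x : G => g * x * g⁻¹) 1

variable (IG G) in
/-- The (left) Maurer-Cartan form: a tangent vector at `g` is carried to `1 = g⁻¹ * g` by the left
translation by `g⁻¹`. -/
def maurerCartan : LieForm IG G IG G :=
  fun g => mfderiv IG IG (fun x : G => g⁻¹ * x) g

/-- `α` is (the connection form of) a principal connection on the principal bundle `M` with right
`G`-action `act`. The vector `d/dt (p exp(tX))` at `t = 0` is the value at `X` of the derivative
of `g ↦ p g` at `1`. -/
structure IsPrincipalConnection [IsManifold IM 1 M] (act : M → G → M)
    (α : LieForm IM M IG G) : Prop where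
  smooth : α.IsSmooth
  vertical : ∀ (p : M) (A : GroupLieAlgebra IG G),
    α (act p 1) (mfderiv IG IM (fun g : G => act p g) 1 A) = A
  equivariant : ∀ (p : M) (g : G) (v : TangentSpace IM p),
    α (act p g) (mfderiv IM IM (fun p' : M => act p' g) p v) = lieAd IG g⁻¹ (α p v)

end Forms

/-! ### Central extensions by the circle -/

section Extension

variable {EK HK K EG HG G : Type*}
  [NormedAddCommGroup EK] [NormedSpace ℝ EK] [TopologicalSpace HK]
  [TopologicalSpace K] [ChartedSpace HK K] [Group K]
  [NormedAddCommGroup EG] [NormedSpace ℝ EG] [TopologicalSpace HG]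
  [TopologicalSpace G] [ChartedSpace HG G] [Group G]

/-- A central extension `1 → 𝕋 → K → G → 1` of Lie groups; as usual, `K → G` is required to be
a smooth principal `𝕋`-bundle. -/
structure CentralExtension (IK : ModelWithCorners ℝ EK HK) (IG : ModelWithCorners ℝ EG HG)
    (K G : Type*) [TopologicalSpace K] [ChartedSpace HK K] [Group K]
    [TopologicalSpace G] [ChartedSpace HG G] [Group G] where
  incl : Circle →* K
  quot : K →* G
  smooth_incl : ContMDiff (𝓡 1) IK ∞ incl
  incl_injective : Function.Injective incl
  quot_surjective : Function.Surjective quot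
  exact : quot.ker = incl.range
  central : ∀ (u : Circle) (k : K), incl u * k = k * incl u
  isPrincipalBundle : IsPrincipalBundle (𝓡 1) IK IG quot (fun (k : K) (u : Circle) => k * incl u)

namespace CentralExtension

variable {IK : ModelWithCorners ℝ EK HK} {IG : ModelWithCorners ℝ EG HG}
  (C : CentralExtension IK IG K G)

/-- The identification of `Lie 𝕋 = iℝ` with a central subspace of `Lie K`. -/
def lieIncl : GroupLieAlgebra (𝓡 1) Circle →L[ℝ] GroupLieAlgebra IK K :=
  lieMap (𝓡 1) IK C.incl

/-- The projection `Lie K → Lie G`. -/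
def lieQuot : GroupLieAlgebra IK K →L[ℝ] GroupLieAlgebra IG G :=
  lieMap IK IG C.quot

/-- The adjoint action of `G` on `Lie K`: `γ` acts as any of its preimages in `K` does. -/
def liftAd (γ : G) : GroupLieAlgebra IK K →L[ℝ] GroupLieAlgebra IK K :=
  lieAd IK (Function.surjInv C.quot_surjective γ)

theorem liftAd_quot (k : K) : C.liftAd (C.quot k) = lieAd IK k := by
  have h : (Function.surjInv C.quot_surjective (C.quot k))⁻¹ * k ∈ C.incl.range := by
    rw [← C.exact, MonoidHom.mem_ker, map_mul, map_inv,
      Function.surjInv_eq C.quot_surjective, inv_mul_cancel]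
  obtain ⟨u, hu⟩ := h
  have hk : k = Function.surjInv C.quot_surjective (C.quot k) * C.incl u := by
    rw [hu, mul_inv_cancel_left]
  unfold liftAd
  generalize Function.surjInv C.quot_surjective (C.quot k) = l at hk
  subst hk
  have : (fun x : K => l * C.incl u * x * (l * C.incl u)⁻¹) = fun x : K => l * x * l⁻¹ := by
    ext x
    rw [mul_assoc l, C.central]
    group
  unfold lieAd
  rw [this]

/-- A (continuous) linear split of `0 → iℝ → Lie K → Lie G → 0`. -/
structure Split where
  toCLM : GroupLieAlgebra IG G →L[ℝ] GroupLieAlgebra IK K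
  lieQuot_comp : ∀ A, C.lieQuot (toCLM A) = A

variable {C} (σ : C.Split)

/-- The group cocycle `Z_σ(γ, A) = Ad_γ σ(A) - σ(Ad_γ A)`, as an element of `Lie K` (it lies in
the central copy of `iℝ`). -/
def Split.groupCocycle (γ : G) : GroupLieAlgebra IG G →L[ℝ] GroupLieAlgebra IK K :=
  (C.liftAd γ).comp σ.toCLM - σ.toCLM.comp (lieAd IG γ)

/-- The one-form `ν_σ = μ_K - σ(q^* μ_G)` on `K` (it takes values in the central copy of `iℝ`). -/
def Split.nu : LieForm IK K IK K :=
  fun k => maurerCartan K IK k - σ.toCLM.comp ((maurerCartan G IG).pullback C.quot k)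

end CentralExtension

end Extension

/-! ### The lifting bundle gerbe -/

section Gerbe

variable {EK HK K EG HG G EB HB B EX HX X : Type*}
  [NormedAddCommGroup EK] [NormedSpace ℝ EK] [TopologicalSpace HK]
  [TopologicalSpace K] [ChartedSpace HK K] [Group K]
  [NormedAddCommGroup EG] [NormedSpace ℝ EG] [TopologicalSpace HG]
  [TopologicalSpace G] [ChartedSpace HG G] [Group G]
  [NormedAddCommGroup EB] [NormedSpace ℝ EB] [TopologicalSpace HB]
  [TopologicalSpace B] [ChartedSpace HB B]
  [NormedAddCommGroup EX] [NormedSpace ℝ EX] [TopologicalSpace HX]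
  [TopologicalSpace X] [ChartedSpace HX X]
  {IK : ModelWithCorners ℝ EK HK} {IG : ModelWithCorners ℝ EG HG}
  {IB : ModelWithCorners ℝ EB HB} {IX : ModelWithCorners ℝ EX HX}

namespace PrincipalBundle

variable (P : PrincipalBundle IG IB IX G B X)

/-- The fibre product `B^[2] = B ×_X B`. -/
def FibreSquare : Type _ := {y : B × B // P.proj y.1 = P.proj y.2}

instance : TopologicalSpace P.FibreSquare := instTopologicalSpaceSubtype

namespace FibreSquare

variable {P}

/-- The first projection `π₁ : B^[2] → B`. -/
def fst (y : P.FibreSquare) : B := y.1.1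

/-- The second projection `π₂ : B^[2] → B`. -/
def snd (y : P.FibreSquare) : B := y.1.2

theorem proj_fst (y : P.FibreSquare) : P.proj y.fst = P.proj y.snd := y.2

/-- The map `ζ : B^[2] → G` with `b₁ ζ(b₁, b₂) = b₂`. -/
def zeta (y : P.FibreSquare) : G := P.isPrincipalBundle.translate y.fst y.snd y.proj_fst

theorem act_zeta (y : P.FibreSquare) : P.act y.fst y.zeta = y.snd :=
  P.isPrincipalBundle.act_translate y.proj_fst

theorem zeta_eq {y : P.FibreSquare} {g : G} (h : P.act y.fst g = y.snd) : y.zeta = g :=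
  P.isPrincipalBundle.eq_translate y.proj_fst h

theorem continuous_fst : Continuous (fst (P := P)) :=
  _root_.continuous_fst.comp continuous_subtype_val

theorem continuous_snd : Continuous (snd (P := P)) :=
  _root_.continuous_snd.comp continuous_subtype_val

variable (P)

theorem continuous_zeta [LieGroup IG ∞ G] : Continuous (zeta (P := P)) := by
  have := topologicalGroup_of_lieGroup (G := G) IG ∞
  exact P.isPrincipalBundle.continuous_translate continuous_fst continuous_snd proj_fst

/-- The homeomorphism `B^[2] ≃ B × G`, `(b, b g) ↔ (b, g)`. -/
def homeo [LieGroup IG ∞ G] : P.FibreSquare ≃ₜ B × G where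
  toFun y := (y.fst, y.zeta)
  invFun z := ⟨(z.1, P.act z.1 z.2), (P.isPrincipalBundle.proj_act z.1 z.2).symm⟩
  left_inv y := Subtype.ext (Prod.ext rfl y.act_zeta)
  right_inv _ := Prod.ext rfl (zeta_eq rfl)
  continuous_toFun := continuous_fst.prodMk (continuous_zeta P)
  continuous_invFun := (_root_.continuous_fst.prodMk
    P.isPrincipalBundle.smooth_act.continuous).subtype_mk _

variable [LieGroup IG ∞ G]

/-- The smooth structure of `B^[2]`, obtained from that of `B × G`. By
`FibreSquare.contMDiff_iff` it is the one of the fibre product of manifolds `B ×_X B`. -/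
instance : ChartedSpace (ModelProd HB HG) P.FibreSquare :=
  transportChartedSpace (homeo P)

instance [IsManifold IB ∞ B] : IsManifold (IB.prod IG) ∞ P.FibreSquare :=
  transport_isManifold (IB.prod IG) (homeo P)

variable {P} in
theorem contMDiff_iff [IsManifold IB ∞ B] {EN HN N : Type*} [NormedAddCommGroup EN]
    [NormedSpace ℝ EN] [TopologicalSpace HN] [TopologicalSpace N] [ChartedSpace HN N]
    {IN : ModelWithCorners ℝ EN HN} {f : N → P.FibreSquare} :
    ContMDiff IN (IB.prod IG) ∞ f ↔
      ContMDiff IN IB ∞ (fun x => (f x).fst) ∧ ContMDiff IN IB ∞ (fun x => (f x).snd) := by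
  obtain ⟨h1, h2⟩ := transport_contMDiff (IB.prod IG) (homeo P)
  constructor
  · intro hf
    have h := h1.comp hf
    refine ⟨h.fst, ?_⟩
    have := P.isPrincipalBundle.smooth_act.comp h
    refine this.congr fun x => ((f x).act_zeta).symm
  · rintro ⟨hf1, hf2⟩
    have := h2.comp (hf1.prodMk
      (P.isPrincipalBundle.contMDiff_translate hf1 hf2 fun x => (f x).proj_fst))
    exact this.congr fun x => ((homeo P).symm_apply_apply (f x)).symm

end FibreSquare

end PrincipalBundle

variable (C : CentralExtension IK IG K G) (P : PrincipalBundle IG IB IX G B X)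

/-- The total space of `J_B = ζ^* K`, the pull-back of `K → G` under `ζ : B^[2] → G`. -/
def LiftingGerbe : Type _ := {j : P.FibreSquare × K // j.1.zeta = C.quot j.2}

namespace LiftingGerbe

instance : TopologicalSpace (LiftingGerbe C P) := instTopologicalSpaceSubtype

variable {C P}

/-- The projection `ρ : J_B → B^[2]`. -/
def proj (j : LiftingGerbe C P) : P.FibreSquare := j.1.1

/-- The canonical map `J_B = ζ^* K → K` covering `ζ`. -/
def lift (j : LiftingGerbe C P) : K := j.1.2

theorem zeta_proj (j : LiftingGerbe C P) : j.proj.zeta = C.quot j.lift := j.2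

/-- The action of `𝕋` on `J_B`. -/
def act (j : LiftingGerbe C P) (u : Circle) : LiftingGerbe C P :=
  ⟨(j.proj, j.lift * C.incl u), by
    have : C.quot (C.incl u) = 1 := by
      rw [← MonoidHom.mem_ker, C.exact]; exact ⟨u, rfl⟩
    simp [zeta_proj, this]⟩

theorem continuous_proj : Continuous (proj (C := C) (P := P)) :=
  continuous_fst.comp continuous_subtype_val

theorem continuous_lift : Continuous (lift (C := C) (P := P)) :=
  continuous_snd.comp continuous_subtype_val

variable (C P)

/-- The homeomorphism `J_B ≃ B × K`, `(b, b q(k), k) ↔ (b, k)`. -/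
def homeo [LieGroup IG ∞ G] : LiftingGerbe C P ≃ₜ B × K where
  toFun j := (j.proj.fst, j.lift)
  invFun z := ⟨((PrincipalBundle.FibreSquare.homeo P).symm (z.1, C.quot z.2), z.2),
    congrArg Prod.snd ((PrincipalBundle.FibreSquare.homeo P).apply_symm_apply (z.1, C.quot z.2))⟩
  left_inv j := by
    refine Subtype.ext (Prod.ext ?_ rfl)
    change (PrincipalBundle.FibreSquare.homeo P).symm (j.proj.fst, C.quot j.lift) = j.proj
    rw [← zeta_proj]
    exact (PrincipalBundle.FibreSquare.homeo P).symm_apply_apply j.proj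
  right_inv z := rfl
  continuous_toFun :=
    (PrincipalBundle.FibreSquare.continuous_fst.comp continuous_proj).prodMk continuous_lift
  continuous_invFun := by
    refine Continuous.subtype_mk (Continuous.prodMk ?_ continuous_snd) _
    exact (PrincipalBundle.FibreSquare.homeo P).symm.continuous.comp
      (continuous_fst.prodMk
        (C.isPrincipalBundle.smooth_proj.continuous.comp continuous_snd))

variable [LieGroup IG ∞ G]

/-- The smooth structure of `J_B`, obtained from that of `B × K`. By `LiftingGerbe.contMDiff_iff`
it is the one of the pull-back `ζ^* K`. -/
instance : ChartedSpace (ModelProd HB HK) (LiftingGerbe C P) :=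
  transportChartedSpace (homeo C P)

variable [LieGroup IK ∞ K] [IsManifold IB ∞ B]

instance : IsManifold (IB.prod IK) ∞ (LiftingGerbe C P) :=
  transport_isManifold (IB.prod IK) (homeo C P)

variable {C P} in
theorem contMDiff_iff {EN HN N : Type*} [NormedAddCommGroup EN]
    [NormedSpace ℝ EN] [TopologicalSpace HN] [TopologicalSpace N] [ChartedSpace HN N]
    {IN : ModelWithCorners ℝ EN HN} {f : N → LiftingGerbe C P} :
    ContMDiff IN (IB.prod IK) ∞ f ↔
      ContMDiff IN (IB.prod IG) ∞ (fun x => (f x).proj) ∧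
        ContMDiff IN IK ∞ (fun x => (f x).lift) := by
  obtain ⟨h1, h2⟩ := transport_contMDiff (IB.prod IK) (homeo C P)
  constructor
  · intro hf
    have h := h1.comp hf
    refine ⟨?_, h.snd⟩
    have hq := C.isPrincipalBundle.smooth_proj.comp h.snd
    have := (transport_contMDiff (IB.prod IG) (PrincipalBundle.FibreSquare.homeo P)).2.comp
      (h.fst.prodMk hq)
    refine this.congr fun x => ?_
    exact congrArg (fun j : LiftingGerbe C P => j.proj)
      ((homeo C P).symm_apply_apply (f x)).symm
  · rintro ⟨hf1, hf2⟩
    have := h2.comp ((PrincipalBundle.FibreSquare.contMDiff_iff.1 hf1).1.prodMk hf2)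
    exact this.congr fun x => ((homeo C P).symm_apply_apply (f x)).symm

end LiftingGerbe

/-- The fibre product over `B^[3]` of `π₁₂^* J_B` and `π₂₃^* J_B`: its points are the pairs of a
point of `J_B` over some `(b₁, b₂)` and a point of `J_B` over some `(b₂, b₃)`. The tensor product
`π₁₂^* J_B ⊗ π₂₃^* J_B` is its quotient by the antidiagonal action of `𝕋`. -/
def ComposablePairs : Type _ :=
  {x : LiftingGerbe C P × LiftingGerbe C P // x.1.proj.snd = x.2.proj.fst}

namespace ComposablePairs

instance : TopologicalSpace (ComposablePairs C P) := instTopologicalSpaceSubtype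

variable {C P}

/-- The projection to `π₁₂^* J_B`, followed by the canonical map to `J_B`. -/
def fst (x : ComposablePairs C P) : LiftingGerbe C P := x.1.1

/-- The projection to `π₂₃^* J_B`, followed by the canonical map to `J_B`. -/
def snd (x : ComposablePairs C P) : LiftingGerbe C P := x.1.2

theorem snd_fst (x : ComposablePairs C P) : x.fst.proj.snd = x.snd.proj.fst := x.2

variable (C P)

/-- The homeomorphism from the composable pairs to `J_B × K` which keeps the first point of `J_B`
and the component in `K` of the second. -/
def homeo [LieGroup IG ∞ G] : ComposablePairs C P ≃ₜ LiftingGerbe C P × K where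
  toFun x := (x.fst, x.snd.lift)
  invFun z := ⟨(z.1, (LiftingGerbe.homeo C P).symm (z.1.proj.snd, z.2)),
    (congrArg Prod.fst ((LiftingGerbe.homeo C P).apply_symm_apply (z.1.proj.snd, z.2))).symm⟩
  left_inv x := by
    refine Subtype.ext (Prod.ext rfl ?_)
    change (LiftingGerbe.homeo C P).symm (x.fst.proj.snd, x.snd.lift) = x.snd
    rw [snd_fst]
    exact (LiftingGerbe.homeo C P).symm_apply_apply x.snd
  right_inv z := rfl
  continuous_toFun := (continuous_fst.comp continuous_subtype_val).prodMk
    (LiftingGerbe.continuous_lift.comp (continuous_snd.comp continuous_subtype_val))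
  continuous_invFun := by
    refine Continuous.subtype_mk (Continuous.prodMk continuous_fst ?_) _
    exact (LiftingGerbe.homeo C P).symm.continuous.comp
      ((PrincipalBundle.FibreSquare.continuous_snd.comp
        (LiftingGerbe.continuous_proj.comp continuous_fst)).prodMk continuous_snd)

variable [LieGroup IG ∞ G]

/-- The smooth structure of the space of composable pairs, obtained from that of `J_B × K`. By
`ComposablePairs.contMDiff_iff` it is the one of the fibre product of manifolds. -/
instance : ChartedSpace (ModelProd (ModelProd HB HK) HK) (ComposablePairs C P) :=
  transportChartedSpace (homeo C P)

variable [LieGroup IK ∞ K] [IsManifold IB ∞ B]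

instance : IsManifold ((IB.prod IK).prod IK) ∞ (ComposablePairs C P) :=
  transport_isManifold ((IB.prod IK).prod IK) (homeo C P)

variable {C P} in
theorem contMDiff_iff {EN HN N : Type*} [NormedAddCommGroup EN]
    [NormedSpace ℝ EN] [TopologicalSpace HN] [TopologicalSpace N] [ChartedSpace HN N]
    {IN : ModelWithCorners ℝ EN HN} {f : N → ComposablePairs C P} :
    ContMDiff IN ((IB.prod IK).prod IK) ∞ f ↔
      ContMDiff IN (IB.prod IK) ∞ (fun x => (f x).fst) ∧
        ContMDiff IN (IB.prod IK) ∞ (fun x => (f x).snd) := by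
  obtain ⟨h1, h2⟩ := transport_contMDiff ((IB.prod IK).prod IK) (homeo C P)
  constructor
  · intro hf
    have h := h1.comp hf
    refine ⟨h.fst, ?_⟩
    have hb := (PrincipalBundle.FibreSquare.contMDiff_iff.1
      (LiftingGerbe.contMDiff_iff.1 h.fst).1).2
    have := (transport_contMDiff (IB.prod IK) (LiftingGerbe.homeo C P)).2.comp
      (hb.prodMk h.snd)
    refine this.congr fun x => ?_
    exact congrArg (fun j : ComposablePairs C P => j.snd)
      ((homeo C P).symm_apply_apply (f x)).symm
  · rintro ⟨hf1, hf2⟩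
    have := h2.comp (hf1.prodMk (LiftingGerbe.contMDiff_iff.1 hf2).2)
    exact this.congr fun x => ((homeo C P).symm_apply_apply (f x)).symm

end ComposablePairs

namespace LiftingGerbe

variable {C P}

/-- The product `J_{(b₁, b₂)} × J_{(b₂, b₃)} → J_{(b₁, b₃)}` induced by the product of `K`. -/
def mul (i j : LiftingGerbe C P) (h : i.proj.snd = j.proj.fst) : LiftingGerbe C P :=
  ⟨(⟨(i.proj.fst, j.proj.snd), by rw [i.proj.proj_fst, h, j.proj.proj_fst]⟩, i.lift * j.lift), by
    refine PrincipalBundle.FibreSquare.zeta_eq ?_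
    change P.act i.proj.fst _ = j.proj.snd
    rw [map_mul, ← zeta_proj, ← zeta_proj, P.isPrincipalBundle.act_mul,
      PrincipalBundle.FibreSquare.act_zeta, h, PrincipalBundle.FibreSquare.act_zeta]⟩

variable (C P) in
/-- The product as a map on the composable pairs. -/
def product (x : ComposablePairs C P) : LiftingGerbe C P := mul x.fst x.snd x.snd_fst

variable [LieGroup IG ∞ G] [LieGroup IK ∞ K] [IsManifold IB ∞ B]

variable (C P) in
/-- `(J_B, B)` is a bundle gerbe over `X`: `B → X` is locally split, `J_B → B^[2]` is a principal
`𝕋`-bundle, and the product is smooth, induces an isomorphism of `𝕋`-bundles `π₁₂^* J_B ⊗ π₂₃^* J_B → π₁₃^* J_B` (by covering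
the identity and being equivariant in each factor) and is associative. -/
structure IsBundleGerbe : Prop where
  locally_split : ∀ x : X, ∃ U : Set X, IsOpen U ∧ x ∈ U ∧ ∃ s : X → B,
    ContMDiffOn IX IB ∞ s U ∧ ∀ y ∈ U, P.proj (s y) = y
  isPrincipalBundle :
    IsPrincipalBundle (𝓡 1) (IB.prod IK) (IB.prod IG) (proj (C := C) (P := P)) act
  smooth_product : ContMDiff ((IB.prod IK).prod IK) (IB.prod IK) ∞ (product C P)
  fst_mul : ∀ (i j : LiftingGerbe C P) h, (mul i j h).proj.fst = i.proj.fst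
  snd_mul : ∀ (i j : LiftingGerbe C P) h, (mul i j h).proj.snd = j.proj.snd
  act_mul : ∀ (i j : LiftingGerbe C P) (h : i.proj.snd = j.proj.fst) (u : Circle),
    mul (i.act u) j h = (mul i j h).act u
  mul_act : ∀ (i j : LiftingGerbe C P) (h : i.proj.snd = j.proj.fst) (u : Circle),
    mul i (j.act u) h = (mul i j h).act u
  mul_assoc : ∀ (i j k : LiftingGerbe C P) (h : i.proj.snd = j.proj.fst)
    (h' : j.proj.snd = k.proj.fst), mul (mul i j h) k h' = mul i (mul j k h') h

/-- `∇` is a bundle gerbe connection on `(J_B, B)`: a connection on the `𝕋`-bundle `J_B → B^[2]`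
with `π₁₂^* ∇ + π₂₃^* ∇ = m^* π₁₃^* ∇`. The latter forms live on `π₁₂^* J_B ⊗ π₂₃^* J_B`; they are
compared after the (injective) pull-back to the fibre product of `π₁₂^* J_B` and `π₂₃^* J_B`. -/
structure IsBundleGerbeConnection
    (nabla : LieForm (IB.prod IK) (LiftingGerbe C P) (𝓡 1) Circle) : Prop where
  isPrincipalConnection : IsPrincipalConnection act nabla
  compatible : ∀ x : ComposablePairs C P,
    nabla.pullback (IN := (IB.prod IK).prod IK) ComposablePairs.fst x +
        nabla.pullback (IN := (IB.prod IK).prod IK) ComposablePairs.snd x =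
      nabla.pullback (IN := (IB.prod IK).prod IK) (product C P) x

/-- The one-form `Z_σ(ζ⁻¹, π₁^* θ)` on `B^[2]`. -/
def cocycleForm (σ : C.Split) (θ : LieForm IB B IG G) :
    LieForm (IB.prod IG) P.FibreSquare IK K :=
  fun y => (σ.groupCocycle y.zeta⁻¹).comp (θ.pullback PrincipalBundle.FibreSquare.fst y)

/-- The one-form `ζ^* ν_σ + ρ^* Z_σ(ζ⁻¹, π₁^* θ)` on `J_B`, before `iℝ ⊆ Lie K` is identified with
`Lie 𝕋`. -/
def connectionForm (σ : C.Split) (θ : LieForm IB B IG G) :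
    LieForm (IB.prod IK) (LiftingGerbe C P) IK K :=
  fun j => σ.nu.pullback lift j +
    (cocycleForm (P := P) σ θ).pullback (IN := IB.prod IK) proj j

end LiftingGerbe

end Gerbe

end

/-! A point of `J_B` amounts to a point b of B and an element k of Γ̂, the second point of B being b
q(k). Hence every pull-back of the connection form is determined by a pair of maps k and b on some
manifold N, and `pairForm` is the form of such a pair. Put c = b q(k). The rule c^*θ = Ad_{q(k)⁻¹}
b^*θ + (q k)^*μ (`IsPrincipalConnection.pullback_act`) rewrites it as k^*μ̂ + Ad_{k⁻¹} σ(b^*θ) -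
σ(c^*θ), the gauge transform by k of the lifted potential at b, minus the lifted potential at c.
Gauge transforms compose, so the Leibniz rule for Maurer–Cartan forms (`maurerCartan_pullback_mul`)
gives form(k l, b) = Ad_{l⁻¹} form(k, b) + form(l, c).

The values lie in the kernel of q_*, because q_* ∘ σ = id and q intertwines Maurer–Cartan forms and
adjoint actions (`lieQuot_pairForm`). A local trivialization of Γ̂ → Γ identifies this kernel with
Lie 𝕋 (`exists_lieIncl_retraction`), where Ad of Γ̂ is trivial by centrality (`lieAd_lieIncl`). So
Ad_{l⁻¹} drops out, and what remains is compatibility with the product (`pairForm_mul`). The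
connection axioms are easier: along a 𝕋-orbit only μ̂ survives, and right multiplication of k by a
central element of the kernel of q changes nothing.

For the gerbe itself, trivializations of Γ̂ → Γ pull back along ζ, and the algebraic axioms are
associativity and centrality in Γ̂. -/

noncomputable section

/-! ### Derivatives, the adjoint action and Maurer–Cartan forms -/

section LieGroupForms

variable {EG HG G EK HK K EM HM M EN HN N : Type*}
  [NormedAddCommGroup EG] [NormedSpace ℝ EG] [TopologicalSpace HG]
  [TopologicalSpace G] [ChartedSpace HG G] [Group G]
  [NormedAddCommGroup EK] [NormedSpace ℝ EK] [TopologicalSpace HK]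
  [TopologicalSpace K] [ChartedSpace HK K] [Group K]
  [NormedAddCommGroup EM] [NormedSpace ℝ EM] [TopologicalSpace HM]
  [TopologicalSpace M] [ChartedSpace HM M]
  [NormedAddCommGroup EN] [NormedSpace ℝ EN] [TopologicalSpace HN]
  [TopologicalSpace N] [ChartedSpace HN N]
  {IM : ModelWithCorners ℝ EM HM} {IN : ModelWithCorners ℝ EN HN}
  {IG : ModelWithCorners ℝ EG HG} {IK : ModelWithCorners ℝ EK HK}

section ChainRule

variable {EL HL L : Type*} [NormedAddCommGroup EL] [NormedSpace ℝ EL] [TopologicalSpace HL]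
  [TopologicalSpace L] [ChartedSpace HL L] {IL : ModelWithCorners ℝ EL HL}

/-- The chain rule, for a base point that is only propositionally equal to `f x`. -/
theorem mfderiv_comp_apply_of_base_eq {g : N → L} {f : M → N} {x : M} {y : N}
    (hg : MDifferentiableAt IN IL g y) (hf : MDifferentiableAt IM IN f x) (hy : f x = y)
    (v : TangentSpace IM x) :
    mfderiv IM IL (fun z => g (f z)) x v =
      @DFunLike.coe (EN →L[ℝ] EL) EN (fun _ => EL) _ (mfderiv IN IL g y) (mfderiv IM IN f x v) := by
  subst hy
  exact mfderiv_comp_apply x hg hf v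

end ChainRule

/-- The derivative of `y ↦ F (y, y)` is the sum of the two partial derivatives. -/
theorem mfderiv_diag_apply {F : M × M → N} {x : M} (hF : MDifferentiableAt (IM.prod IM) IN F (x, x))
    (v : TangentSpace IM x) :
    mfderiv IM IN (fun y => F (y, y)) x v =
      @HAdd.hAdd EN EN EN _ (mfderiv IM IN (fun y => F (y, x)) x v)
        (mfderiv IM IN (fun y => F (x, y)) x v) := by
  have hd : MDifferentiableAt IM (IM.prod IM) (fun y : M => (y, y)) x :=
    mdifferentiableAt_id.prodMk mdifferentiableAt_id
  have h1 : mfderiv IM IN (fun y => F (y, y)) x v =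
      mfderiv (IM.prod IM) IN F (x, x) (mfderiv IM (IM.prod IM) (fun y : M => (y, y)) x v) :=
    mfderiv_comp_apply_of_base_eq hF hd rfl v
  have h2 : mfderiv IM (IM.prod IM) (fun y : M => (y, y)) x v = (v, v) := by
    have := mfderiv_prodMk (I := IM) (I' := IM) (I'' := IM) (x := x)
      (mdifferentiableAt_id (I := IM)) (mdifferentiableAt_id (I := IM))
    rw [mfderiv_id] at this
    exact DFunLike.congr_fun this v
  rw [h1, h2]
  exact mfderiv_prod_eq_add_apply hF

section Pullback

variable {EL HL L : Type*} [NormedAddCommGroup EL] [NormedSpace ℝ EL] [TopologicalSpace HL]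
  [TopologicalSpace L] [ChartedSpace HL L] {IL : ModelWithCorners ℝ EL HL}

theorem LieForm.pullback_pullback (α : LieForm IM M IG G) {f : N → M} {g : L → N} {x : L}
    (hf : MDifferentiableAt IN IM f (g x)) (hg : MDifferentiableAt IL IN g x) :
    LieForm.pullback (IN := IL) g (LieForm.pullback (IN := IN) f α) x =
      LieForm.pullback (IN := IL) (fun y => f (g y)) α x := by
  have h := mfderiv_comp x hf hg
  ext v
  exact congrArg (α (f (g x))) (DFunLike.congr_fun h v).symm

end Pullback

/-- By the chain rule the form becomes the derivative of one map with value 1 at x. Identities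
between Maurer–Cartan forms then follow from algebraic identities between group-valued functions. -/
theorem maurerCartan_pullback_apply [LieGroup IG ∞ G] {f : M → G} {x : M}
    (hf : MDifferentiableAt IM IG f x) (v : TangentSpace IM x) :
    (maurerCartan G IG).pullback (IN := IM) f x v =
      mfderiv IM IG (fun y => (f x)⁻¹ * f y) x v := by
  have hl : MDifferentiableAt IG IG (fun z : G => (f x)⁻¹ * z) (f x) :=
    (contMDiff_mul_left (I := IG) (n := ∞)).mdifferentiableAt (by simp)
  exact (mfderiv_comp_apply x hl hf v).symm

theorem mdifferentiable_conj [LieGroup IG ∞ G] (g : G) :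
    MDifferentiable IG IG (fun x : G => g * x * g⁻¹) :=
  (((contMDiff_const (c := g)).mul contMDiff_id).mul
    (contMDiff_const (c := g⁻¹))).mdifferentiable (n := ∞) (by simp)

/-- The derivative of a conjugate of a map through `1`. -/
theorem lieAd_mfderiv [LieGroup IG ∞ G] (g : G) {f : M → G} {x : M}
    (hf : MDifferentiableAt IM IG f x) (hx : f x = 1) (v : TangentSpace IM x) :
    lieAd IG g (mfderiv IM IG f x v) = mfderiv IM IG (fun y => g * f y * g⁻¹) x v :=
  (mfderiv_comp_apply_of_base_eq (mdifferentiable_conj g 1) hf hx v).symm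

theorem lieMap_mfderiv {f : G →* K} (hfs : MDifferentiableAt IG IK f 1) {g : M → G} {x : M}
    (hg : MDifferentiableAt IM IG g x) (hx : g x = 1) (v : TangentSpace IM x) :
    lieMap IG IK f (mfderiv IM IG g x v) = mfderiv IM IK (fun y => f (g y)) x v :=
  (mfderiv_comp_apply_of_base_eq hfs hg hx v).symm

theorem lieAd_mul [LieGroup IG ∞ G] (g h : G) (A : GroupLieAlgebra IG G) :
    lieAd IG (g * h) A = lieAd IG g (lieAd IG h A) := by
  have := lieAd_mfderiv (IM := IG) g (mdifferentiable_conj (IG := IG) h 1) (by simp) A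
  refine Eq.trans ?_ this.symm
  unfold lieAd
  congr 2
  ext x
  group

/-- Differentiate f(g x g⁻¹) = f(g) f(x) f(g)⁻¹ at x = 1. -/
theorem lieMap_lieAd [LieGroup IG ∞ G] [LieGroup IK ∞ K] {f : G →* K}
    (hf : ContMDiff IG IK ∞ f) (g : G) (A : GroupLieAlgebra IG G) :
    lieMap IG IK f (lieAd IG g A) = lieAd IK (f g) (lieMap IG IK f A) := by
  have hf' := hf.mdifferentiable (by simp)
  have h1 := lieMap_mfderiv (IM := IG) (hf' 1) (mdifferentiable_conj (IG := IG) g 1) (by simp) A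
  have h2 := lieAd_mfderiv (IM := IG) (IG := IK) (f g) (hf' 1) (map_one f) A
  refine h1.trans (Eq.trans ?_ h2.symm)
  congr 2
  ext x
  simp

theorem lieMap_maurerCartan_pullback [LieGroup IG ∞ G] [LieGroup IK ∞ K] {f : G →* K}
    (hf : ContMDiff IG IK ∞ f) {g : M → G} {x : M} (hg : MDifferentiableAt IM IG g x)
    (v : TangentSpace IM x) :
    lieMap IG IK f ((maurerCartan G IG).pullback (IN := IM) g x v) =
      (maurerCartan K IK).pullback (IN := IM) (fun y => f (g y)) x v := by
  have hf' := hf.mdifferentiable (by simp)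
  have hl : MDifferentiableAt IM IG (fun y => (g x)⁻¹ * g y) x :=
    ((contMDiff_mul_left (I := IG) (n := ∞)).mdifferentiableAt (by simp)).comp x hg
  rw [maurerCartan_pullback_apply hg]
  refine (lieMap_mfderiv (hf' 1) hl (by simp) v).trans ?_
  refine Eq.trans ?_ (maurerCartan_pullback_apply (f := fun y => f (g y))
    ((hf' (g x)).comp x hg) v).symm
  congr 2
  ext y
  simp

/-- The two factors are varied separately. Varying only f, the difference from the base point is
(f(x)⁻¹ f(y)) conjugated by h(x)⁻¹, whence the adjoint term; varying only h, f cancels. -/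
theorem maurerCartan_pullback_mul [LieGroup IG ∞ G] {f h : M → G} {x : M}
    (hf : MDifferentiableAt IM IG f x) (hh : MDifferentiableAt IM IG h x)
    (v : TangentSpace IM x) :
    (maurerCartan G IG).pullback (IN := IM) (fun y => f y * h y) x v =
      lieAd IG (h x)⁻¹ ((maurerCartan G IG).pullback (IN := IM) f x v) +
        (maurerCartan G IG).pullback (IN := IM) h x v := by
  have hmul : MDifferentiable (IG.prod IG) IG (fun p : G × G => p.1 * p.2) :=
    (contMDiff_mul IG ∞).mdifferentiable (by simp)
  have hleft (a : G) : MDifferentiable IG IG (fun z : G => a * z) :=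
    (contMDiff_mul_left (I := IG) (n := ∞)).mdifferentiable (by simp)
  have hfh : MDifferentiableAt (IM.prod IM) IG (fun p : M × M => f p.1 * h p.2) (x, x) :=
    (hmul (f x, h x)).comp (x, x)
      (MDifferentiableAt.prodMk (MDifferentiableAt.comp (x, x) hf mdifferentiableAt_fst)
        (MDifferentiableAt.comp (x, x) hh mdifferentiableAt_snd))
  have hF : MDifferentiableAt (IM.prod IM) IG
      (fun p : M × M => (f x * h x)⁻¹ * (f p.1 * h p.2)) (x, x) :=
    (hleft _ _).comp (x, x) hfh
  have hm : MDifferentiableAt IM IG (fun y => f y * h y) x :=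
    (hmul (f x, h x)).comp x (hf.prodMk hh)
  rw [maurerCartan_pullback_apply hm, maurerCartan_pullback_apply hf,
    maurerCartan_pullback_apply hh]
  refine (mfderiv_diag_apply hF v).trans ?_
  have h1 := lieAd_mfderiv (f := fun y => (f x)⁻¹ * f y) (h x)⁻¹
    ((hleft (f x)⁻¹ (f x)).comp x hf) (by simp) v
  have e1 : (fun y => (f x * h x)⁻¹ * (f y * h x)) =
      fun y => (h x)⁻¹ * ((f x)⁻¹ * f y) * (h x)⁻¹⁻¹ := by
    ext y; group
  have e2 : (fun y => (f x * h x)⁻¹ * (f x * h y)) = fun y => (h x)⁻¹ * h y := by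
    ext y; group
  rw [← e1] at h1
  -- The addition is taken in the model space: the summands are tangent vectors at base points that
  -- equal 1 only propositionally.
  refine congrArg₂ (fun a b : EG => a + b) h1.symm ?_
  exact congrArg (fun k : M → G => (mfderiv IM IG k x : EM →L[ℝ] EG) v) e2

/-- The value of a connection form on the derivative of `y ↦ p(y) g(y)`. -/
theorem IsPrincipalConnection.pullback_act [LieGroup IG ∞ G] [IsManifold IN 1 N]
    {act : N → G → N} {α : LieForm IN N IG G} (hα : IsPrincipalConnection act α)
    (hact : ContMDiff (IN.prod IG) IN ∞ (fun x : N × G => act x.1 x.2))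
    (act_mul : ∀ p g h, act p (g * h) = act (act p g) h) (act_one : ∀ p, act p 1 = p)
    {p : M → N} {g : M → G} {x : M} (hp : MDifferentiableAt IM IN p x)
    (hg : MDifferentiableAt IM IG g x) (v : TangentSpace IM x) :
    α.pullback (IN := IM) (fun y => act (p y) (g y)) x v =
      lieAd IG (g x)⁻¹ (α.pullback (IN := IM) p x v) +
        (maurerCartan G IG).pullback (IN := IM) g x v := by
  have hact' := hact.mdifferentiable (by simp)
  have hF : MDifferentiableAt (IM.prod IM) IN
      (fun z : M × M => act (p z.1) (g z.2)) (x, x) :=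
    (hact' (p x, g x)).comp (x, x)
      (MDifferentiableAt.prodMk (MDifferentiableAt.comp (x, x) hp mdifferentiableAt_fst)
        (MDifferentiableAt.comp (x, x) hg mdifferentiableAt_snd))
  have hR : MDifferentiableAt IN IN (fun q => act q (g x)) (p x) :=
    (hact' (p x, g x)).comp (p x)
      (MDifferentiableAt.prodMk mdifferentiableAt_id mdifferentiableAt_const)
  have hL : MDifferentiableAt IG IN (fun h => act (act (p x) (g x)) h) 1 :=
    (hact' (act (p x) (g x), 1)).comp 1
      (MDifferentiableAt.prodMk mdifferentiableAt_const mdifferentiableAt_id)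
  have hl : MDifferentiableAt IM IG (fun y => (g x)⁻¹ * g y) x :=
    ((contMDiff_mul_left (I := IG) (n := ∞)).mdifferentiableAt (by simp)).comp x hg
  -- Rebasing the orbit at p(x) g(x) makes the moving group element pass through 1 at x, where the
  -- vertical axiom applies.
  have e2 : (fun y => act (p x) (g y)) =
      fun y => act (act (p x) (g x)) ((g x)⁻¹ * g y) := by
    ext y; rw [← act_mul, mul_inv_cancel_left]
  have h1 : mfderiv IM IN (fun y => act (p y) (g x)) x v =
      mfderiv IN IN (fun q => act q (g x)) (p x) (mfderiv IM IN p x v) :=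
    mfderiv_comp_apply x hR hp v
  have h2 : mfderiv IM IN (fun y => act (p x) (g y)) x v =
      mfderiv IG IN (fun h => act (act (p x) (g x)) h) 1
        (mfderiv IM IG (fun y => (g x)⁻¹ * g y) x v) := by
    rw [e2]
    exact mfderiv_comp_apply_of_base_eq hL hl (by simp) v
  have h3 := hα.equivariant (p x) (g x) (mfderiv IM IN p x v)
  have h4 := hα.vertical (act (p x) (g x)) (mfderiv IM IG (fun y => (g x)⁻¹ * g y) x v)
  rw [act_one] at h4
  rw [maurerCartan_pullback_apply hg]
  refine (congrArg (α (act (p x) (g x))) (mfderiv_diag_apply hF v)).trans ?_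
  refine ((α (act (p x) (g x))).map_add _ _).trans ?_
  exact congrArg₂ (fun a b : EG => a + b) ((congrArg (α (act (p x) (g x))) h1).trans h3)
    ((congrArg (α (act (p x) (g x))) h2).trans h4)

/-! ### Smoothness of Lie algebra valued forms -/

theorem LieForm.IsSmooth.pullback [IsManifold IM ∞ M] [IsManifold IN ∞ N]
    {α : LieForm IM M IG G} (hα : α.IsSmooth) {f : N → M} (hf : ContMDiff IN IM ∞ f) :
    (LieForm.pullback (IN := IN) f α).IsSmooth :=
  ContMDiff.comp (M'' := EG) hα (hf.contMDiff_tangentMap (m := ∞) (by simp))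

/-- A derivative depends smoothly on parameters when read in tangent coordinates. Conjugation fixes
1, so both base points stay at 1 and these coordinates are the identity. -/
theorem contMDiff_lieAd [LieGroup IG ∞ G] :
    ContMDiff (M' := EG →L[ℝ] EG) IG 𝓘(ℝ, EG →L[ℝ] EG) ∞ (fun g : G => lieAd IG g) := by
  intro g₀
  have hc : ContMDiff (IG.prod IG) IG ∞ (fun p : G × G => p.1 * p.2 * p.1⁻¹) :=
    (contMDiff_fst.mul contMDiff_snd).mul contMDiff_fst.inv
  have h := ContMDiffAt.mfderiv (I := IG) (I' := IG) (J := IG) (x₀ := g₀) (n := ∞) (m := ∞)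
    (fun g x : G => g * x * g⁻¹) (fun _ => 1) (hc (g₀, 1)) contMDiffAt_const (by simp)
  refine h.congr_of_eventuallyEq (Filter.Eventually.of_forall fun g => ?_)
  have e : ∀ g : G, g * 1 * g⁻¹ = 1 := fun g => by simp
  refine Eq.trans ?_ (inTangentCoordinates_eq (I := IG) (I' := IG) (fun _ : G => (1 : G))
    (fun g : G => g * 1 * g⁻¹) (fun g => lieAd IG g) (mem_chart_source HG 1)
    (by rw [e, e]; exact mem_chart_source HG 1)).symm
  have hk : ∀ (k : G → G), (∀ g, k g = 1) → ∀ w, (tangentBundleCore IG G).coordChange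
      (achart HG (k g)) (achart HG (k g₀)) (k g) w = w := by
    intro k hk w
    rw [hk, hk]
    exact (tangentBundleCore IG G).coordChange_self _ _ (mem_achart_source HG 1) w
  ext w
  refine Eq.trans ?_ (hk _ e _).symm
  exact congrArg (lieAd IG g)
    ((tangentBundleCore IG G).coordChange_self _ _ (mem_achart_source HG 1) w).symm

/-- The form is part of the tangent map of (g, h) ↦ g⁻¹ h, restricted to the diagonal and to vectors
(0, v). This exhibits it as a smooth map of tangent bundles whose image lies over 1. -/
theorem maurerCartan_isSmooth [LieGroup IG ∞ G] : (maurerCartan G IG).IsSmooth := by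
  let F : TangentBundle IG G → TangentBundle IG G := fun v =>
    tangentMap (IG.prod IG) IG (fun p : G × G => p.1⁻¹ * p.2)
      ((equivTangentBundleProd IG G IG G).symm (⟨v.1, 0⟩, v))
  have hF : ContMDiff IG.tangent IG.tangent ∞ F := by
    have hd : ContMDiff (IG.prod IG) IG ∞ (fun p : G × G => p.1⁻¹ * p.2) :=
      contMDiff_fst.inv.mul contMDiff_snd
    refine (hd.contMDiff_tangentMap (m := ∞) (by simp)).comp
      (contMDiff_equivTangentBundleProd_symm.comp (ContMDiff.prodMk ?_ contMDiff_id))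
    exact (contMDiff_zeroSection ℝ (TangentSpace IG : G → Type _)).comp (contMDiff_proj _)
  intro v₀
  have h := (contMDiffAt_totalSpace.1 (hF v₀)).2
  refine h.congr_of_eventuallyEq (Filter.Eventually.of_forall fun v => ?_)
  -- The bundle coordinate centred at x is the identity on the fibre over x itself; here that fibre
  -- is the one over 1.
  have key : ∀ (z : TangentBundle IG G) (x : G), z.1 = x →
      (trivializationAt EG (TangentSpace IG) x z).2 = z.2 := by
    rintro ⟨z, w⟩ _ rfl
    exact (tangentBundleCore IG G).coordChange_self _ _ (mem_achart_source HG z) w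
  refine Eq.trans ?_ (key (F v) (F v₀).1 (by simp [F, tangentMap])).symm
  have hd : MDifferentiableAt (IG.prod IG) IG (fun p : G × G => p.1⁻¹ * p.2) (v.1, v.1) :=
    (contMDiff_fst.inv.mul contMDiff_snd).mdifferentiableAt (n := ∞) (by simp)
  let w : EG := v.2
  refine Eq.trans ?_ (mfderiv_prod_eq_add_apply (v := ((0, w) : EG × EG)) hd).symm
  have h0 : mfderiv IG IG (fun z : G => z⁻¹ * v.1) v.1 0 = 0 := map_zero _
  let m : EG := maurerCartan G IG v.1 v.2
  exact ((congrArg (fun a : EG => a + m) h0).trans (zero_add m)).symm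

theorem LieForm.IsSmooth.lieAd_comp [LieGroup IG ∞ G] [IsManifold IM ∞ M]
    {α : LieForm IM M IG G} (hα : α.IsSmooth) {g : M → G} (hg : ContMDiff IM IG ∞ g) :
    LieForm.IsSmooth (fun x => (lieAd IG (g x)).comp (α x)) :=
  ContMDiff.clm_apply (F₁ := EG) (F₂ := EG)
    (contMDiff_lieAd.comp (hg.comp (contMDiff_proj (TangentSpace IM : M → Type _)))) hα

theorem LieForm.IsSmooth.clm_comp [IsManifold IM 1 M]
    {α : LieForm IM M IG G} (hα : α.IsSmooth)
    (l : GroupLieAlgebra IG G →L[ℝ] GroupLieAlgebra IK K) :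
    LieForm.IsSmooth (fun x => l.comp (α x)) :=
  ContMDiff.comp (M' := EG) (M'' := EK) (I' := 𝓘(ℝ, EG))
    (ContinuousLinearMap.contMDiff (E := EG) (F := EK) l) hα

theorem LieForm.IsSmooth.add [IsManifold IM 1 M] {α β : LieForm IM M IG G} (hα : α.IsSmooth)
    (hβ : β.IsSmooth) : LieForm.IsSmooth (fun x => α x + β x) :=
  ContMDiff.add (G := EG) hα hβ

theorem LieForm.IsSmooth.sub [IsManifold IM 1 M] {α β : LieForm IM M IG G} (hα : α.IsSmooth)
    (hβ : β.IsSmooth) : LieForm.IsSmooth (fun x => α x - β x) :=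
  ContMDiff.sub (G := EG) hα hβ

end LieGroupForms

/-! ### The central extension of Lie algebras -/

section LieSequence

variable {EK HK K EG HG G : Type*}
  [NormedAddCommGroup EK] [NormedSpace ℝ EK] [TopologicalSpace HK]
  [TopologicalSpace K] [ChartedSpace HK K] [Group K]
  [NormedAddCommGroup EG] [NormedSpace ℝ EG] [TopologicalSpace HG]
  [TopologicalSpace G] [ChartedSpace HG G] [Group G]
  {IK : ModelWithCorners ℝ EK HK} {IG : ModelWithCorners ℝ EG HG}

theorem lieAd_circle (u : Circle) (A : GroupLieAlgebra (𝓡 1) Circle) :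
    lieAd (𝓡 1) u A = A := by
  have e : (fun x : Circle => u * x * u⁻¹) = id := by
    ext x
    simp [mul_comm u x]
  unfold lieAd
  rw [e, mfderiv_id]
  rfl

namespace CentralExtension

theorem quot_incl (C : CentralExtension IK IG K G) (u : Circle) : C.quot (C.incl u) = 1 := by
  rw [← MonoidHom.mem_ker, C.exact]
  exact ⟨u, rfl⟩

theorem smooth_quot (C : CentralExtension IK IG K G) : ContMDiff IK IG ∞ C.quot :=
  C.isPrincipalBundle.smooth_proj

variable [LieGroup IK ∞ K]

/-- The sequence `0 → Lie 𝕋 → Lie K → Lie G` is exact, and the first map has a continuous left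
inverse. -/
theorem exists_lieIncl_retraction (C : CentralExtension IK IG K G) :
    ∃ l : GroupLieAlgebra IK K →L[ℝ] GroupLieAlgebra (𝓡 1) Circle,
      (∀ a, l (C.lieIncl a) = a) ∧ ∀ v, C.lieQuot v = 0 → C.lieIncl (l v) = v := by
  obtain ⟨e, he, hs, hs', heq⟩ := C.isPrincipalBundle.locally_trivial 1
  have h1 : (1 : K) ∈ e.source := e.mem_source.2 (by rwa [map_one])
  have hq : MDifferentiable IK IG C.quot := C.smooth_quot.mdifferentiable (by simp)
  have hi : MDifferentiable (𝓡 1) IK C.incl := C.smooth_incl.mdifferentiable (by simp)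
  have he2 : ∀ k ∈ e.source, ∀ u, (e (k * C.incl u)).2 = (e k).2 * u := fun k hk u => by
    rw [heq k hk u]
  -- The fibre coordinate, normalized to be 1 at the identity; its derivative there is the
  -- retraction. The section s is normalized in the same way, so that s(1) = 1.
  let r : K → Circle := fun k => (e 1).2⁻¹ * (e k).2
  let s : G → K := fun g => e.toOpenPartialHomeomorph.symm (g, (e 1).2)
  have hr : MDifferentiableAt IK (𝓡 1) r 1 := by
    have := (hs.contMDiffAt (e.open_source.mem_nhds h1)).snd
    exact ((contMDiffAt_const (c := (e 1).2⁻¹)).mul this).mdifferentiableAt (by simp)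
  have hr1 : r 1 = 1 := inv_mul_cancel _
  have hst : MDifferentiableAt IG IK s 1 := by
    have ht : ((1 : G), (e 1).2) ∈ e.target := e.mem_target.2 he
    have := hs'.contMDiffAt (e.open_target.mem_nhds ht)
    exact (ContMDiffAt.comp (1 : G) this
      (contMDiffAt_id.prodMk contMDiffAt_const)).mdifferentiableAt (by simp)
  have hs1 : s 1 = 1 := by
    have : ((1 : G), (e 1).2) = e 1 := by
      refine Prod.ext ?_ rfl
      rw [e.coe_fst h1, map_one]
    change e.toOpenPartialHomeomorph.symm (1, (e 1).2) = 1
    rw [this]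
    exact e.toOpenPartialHomeomorph.left_inv h1
  refine ⟨mfderiv IK (𝓡 1) r 1, fun a => ?_, fun v hv => ?_⟩
  · have h2 := mfderiv_comp_apply_of_base_eq hr (hi 1) (map_one C.incl) a
    refine h2.symm.trans ?_
    have e1 : (fun u => r (C.incl u)) = id := by
      ext u
      have := he2 1 h1 u
      rw [one_mul] at this
      simp [r, this]
    rw [e1, mfderiv_id]
    rfl
  · have hmul : MDifferentiable (IK.prod IK) IK (fun p : K × K => p.1 * p.2) :=
      (contMDiff_mul IK ∞).mdifferentiable (by simp)
    have hsq : MDifferentiableAt IK IK (fun y => s (C.quot y)) 1 :=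
      MDifferentiableAt.comp (g := s) (1 : K) (by rw [map_one]; exact hst) (hq 1)
    have hir : MDifferentiableAt IK IK (fun y => C.incl (r y)) 1 := (hi (r 1)).comp (1 : K) hr
    have hF : MDifferentiableAt (IK.prod IK) IK
        (fun p : K × K => s (C.quot p.1) * C.incl (r p.2)) (1, 1) :=
      (hmul (s (C.quot 1), C.incl (r 1))).comp ((1 : K), (1 : K))
        (MDifferentiableAt.prodMk (MDifferentiableAt.comp ((1 : K), (1 : K)) hsq
          mdifferentiableAt_fst) (MDifferentiableAt.comp ((1 : K), (1 : K)) hir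
          mdifferentiableAt_snd))
    have hd := mfderiv_diag_apply hF v
    -- Near 1 every y factors as s(q(y)) times the image of r(y). Differentiating at 1 splits v into
    -- ds(q_* v), which vanishes on the kernel, and the image of dr(v).
    have hid : (fun y => s (C.quot y) * C.incl (r y)) =ᶠ[nhds 1] id := by
      filter_upwards [e.open_source.mem_nhds h1] with y hy
      have hyb : C.quot y ∈ e.baseSet := e.mem_source.1 hy
      have hss : s (C.quot y) ∈ e.source := e.map_target (e.mem_target.2 hyb)
      have hes : e (s (C.quot y)) = (C.quot y, (e 1).2) :=
        e.toOpenPartialHomeomorph.right_inv (e.mem_target.2 hyb)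
      have hys : s (C.quot y) * C.incl (r y) ∈ e.source := e.mem_source.2 (by
        rw [C.isPrincipalBundle.proj_act, ← e.coe_fst hss, hes]; exact hyb)
      refine e.injOn hys hy ?_
      change e (s (C.quot y) * C.incl (r y)) = e y
      rw [heq _ hss, hes]
      refine Prod.ext (e.coe_fst hy).symm ?_
      simp [r]
    have e1 : (fun y => s (C.quot y) * C.incl (r 1)) = fun y => s (C.quot y) := by
      ext y; rw [hr1, map_one, mul_one]
    have e2 : (fun y => s (C.quot 1) * C.incl (r y)) = fun y => C.incl (r y) := by
      ext y; rw [map_one, hs1, one_mul]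
    have h3 : mfderiv IK IK (fun y => s (C.quot y)) 1 v = 0 := by
      refine (mfderiv_comp_apply_of_base_eq hst (hq 1) (map_one C.quot) v).trans ?_
      refine (congrArg (mfderiv IG IK s 1) hv).trans ?_
      exact map_zero _
    have h4 : mfderiv IK IK (fun y => C.incl (r y)) 1 v =
        C.lieIncl (mfderiv IK (𝓡 1) r 1 v) :=
      mfderiv_comp_apply_of_base_eq (hi 1) hr hr1 v
    have h5 : mfderiv IK IK (fun y => s (C.quot y) * C.incl (r y)) 1 v = v := by
      rw [hid.mfderiv_eq, mfderiv_id]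
      rfl
    refine Eq.symm (h5.symm.trans (hd.trans ?_))
    refine (congrArg₂ (fun a b : EK => a + b) ?_ ?_).trans
      (zero_add (C.lieIncl (mfderiv IK (𝓡 1) r 1 v) : EK))
    · exact (congrArg (fun k : K → K => (mfderiv IK IK k 1 : EK →L[ℝ] EK) v) e1).trans h3
    · exact (congrArg (fun k : K → K => (mfderiv IK IK k 1 : EK →L[ℝ] EK) v) e2).trans h4

/-- This allows equalities of forms with values in Lie 𝕋 to be checked in Lie Γ̂, where the
connection form is given explicitly. -/
theorem lieIncl_injective (C : CentralExtension IK IG K G) : Function.Injective C.lieIncl := by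
  obtain ⟨l, hl, -⟩ := C.exists_lieIncl_retraction
  exact Function.LeftInverse.injective hl

/-- Conjugation fixes the central circle pointwise, hence its tangent vectors. -/
theorem lieAd_lieIncl (C : CentralExtension IK IG K G) (k : K)
    (A : GroupLieAlgebra (𝓡 1) Circle) : lieAd IK k (C.lieIncl A) = C.lieIncl A := by
  have hi : MDifferentiable (𝓡 1) IK C.incl := C.smooth_incl.mdifferentiable (by simp)
  refine (lieAd_mfderiv k (hi 1) (map_one C.incl) A).trans ?_
  have e : (fun y => k * C.incl y * k⁻¹) = C.incl := by
    ext y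
    rw [← C.central, mul_inv_cancel_right]
  exact congrArg (fun f : Circle → K => (mfderiv (𝓡 1) IK f 1 :
    EuclideanSpace ℝ (Fin 1) →L[ℝ] EK) A) e

end CentralExtension

end LieSequence

/-! ### The form attached to a pair of maps to Γ̂ and B -/

section ConnectionForm

variable {EK HK K EG HG G EB HB B EX HX X EN HN N : Type*}
  [NormedAddCommGroup EK] [NormedSpace ℝ EK] [TopologicalSpace HK]
  [TopologicalSpace K] [ChartedSpace HK K] [Group K]
  [NormedAddCommGroup EG] [NormedSpace ℝ EG] [TopologicalSpace HG]
  [TopologicalSpace G] [ChartedSpace HG G] [Group G]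
  [NormedAddCommGroup EB] [NormedSpace ℝ EB] [TopologicalSpace HB]
  [TopologicalSpace B] [ChartedSpace HB B]
  [NormedAddCommGroup EX] [NormedSpace ℝ EX] [TopologicalSpace HX]
  [TopologicalSpace X] [ChartedSpace HX X]
  [NormedAddCommGroup EN] [NormedSpace ℝ EN] [TopologicalSpace HN]
  [TopologicalSpace N] [ChartedSpace HN N]
  {IK : ModelWithCorners ℝ EK HK} {IG : ModelWithCorners ℝ EG HG}
  {IB : ModelWithCorners ℝ EB HB} {IX : ModelWithCorners ℝ EX HX}
  {IN : ModelWithCorners ℝ EN HN}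
  {C : CentralExtension IK IG K G}

/-- The one-form `k^* ν_σ + Z_σ(q(k)⁻¹, b^* θ)` on `N` given by maps `k : N → K` and `b : N → B`. -/
def CentralExtension.Split.pairForm (σ : C.Split) (θ : LieForm IB B IG G)
    (k : N → K) (b : N → B) : LieForm IN N IK K := fun x =>
  ((maurerCartan K IK).pullback (IN := IN) k x -
      σ.toCLM.comp ((maurerCartan G IG).pullback (IN := IN) (fun y => C.quot (k y)) x)) +
    ((lieAd IK (k x)⁻¹).comp (σ.toCLM.comp (θ.pullback (IN := IN) b x)) -
      σ.toCLM.comp ((lieAd IG (C.quot (k x))⁻¹).comp (θ.pullback (IN := IN) b x)))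

theorem CentralExtension.Split.pairForm_apply (σ : C.Split) (θ : LieForm IB B IG G)
    (k : N → K) (b : N → B) (x : N) (v : TangentSpace IN x) :
    σ.pairForm (IN := IN) θ k b x v =
      ((maurerCartan K IK).pullback (IN := IN) k x v -
        σ.toCLM ((maurerCartan G IG).pullback (IN := IN) (fun y => C.quot (k y)) x v)) +
      (lieAd IK (k x)⁻¹ (σ.toCLM (θ.pullback (IN := IN) b x v)) -
        σ.toCLM (lieAd IG (C.quot (k x))⁻¹ (θ.pullback (IN := IN) b x v))) := rfl

variable [LieGroup IK ∞ K]

/-- Along a 𝕋-orbit both b and q(k) are constant, so the terms with θ and μ vanish and only μ̂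
contributes. This yields the vertical axiom. -/
theorem CentralExtension.Split.pairForm_mul_incl_apply (σ : C.Split) (θ : LieForm IB B IG G)
    (k : K) (b : B) (A : GroupLieAlgebra (𝓡 1) Circle) :
    σ.pairForm (IN := 𝓡 1) θ (fun u : Circle => k * C.incl u) (fun _ => b) 1 A = C.lieIncl A := by
  have hk : MDifferentiableAt (𝓡 1) IK (fun u : Circle => k * C.incl u) 1 :=
    (contMDiff_const.mul C.smooth_incl).mdifferentiableAt (n := ∞) (by simp)
  have h1 : (maurerCartan K IK).pullback (IN := 𝓡 1) (fun u : Circle => k * C.incl u) 1 A =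
      C.lieIncl A := by
    refine (maurerCartan_pullback_apply hk A).trans ?_
    have e : (fun u : Circle => (k * C.incl 1)⁻¹ * (k * C.incl u)) = C.incl := by
      ext u; simp
    exact congrArg (fun f : Circle → K => (mfderiv (𝓡 1) IK f 1 :
      EuclideanSpace ℝ (Fin 1) →L[ℝ] EK) A) e
  have h2 : (maurerCartan G IG).pullback (IN := 𝓡 1)
      (fun u : Circle => C.quot (k * C.incl u)) 1 A = 0 := by
    have e : (fun u : Circle => C.quot (k * C.incl u)) = fun _ => C.quot k := by
      ext u; rw [map_mul, C.quot_incl, mul_one]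
    rw [e]
    refine (congrArg (maurerCartan G IG (C.quot k)) ?_).trans (map_zero _)
    exact DFunLike.congr_fun (mfderiv_const (I := 𝓡 1) (I' := IG) (x := (1 : Circle))
      (c := C.quot k)) A
  have h3 : θ.pullback (IN := 𝓡 1) (fun _ : Circle => b) 1 A = 0 := by
    refine (congrArg (θ b) ?_).trans (map_zero _)
    exact DFunLike.congr_fun (mfderiv_const (I := 𝓡 1) (I' := IB) (x := (1 : Circle))
      (c := b)) A
  rw [σ.pairForm_apply, h1, h2, h3]
  simp only [map_zero, sub_zero, add_zero]

/-- A central factor cancels in k(x)⁻¹ k(y), is killed by q, and acts trivially under Ad. This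
yields the equivariance axiom. -/
theorem CentralExtension.Split.pairForm_mul_incl (σ : C.Split) (θ : LieForm IB B IG G)
    {k : N → K} (u : Circle) (b : N → B) {x : N} (hk : MDifferentiableAt IN IK k x)
    (v : TangentSpace IN x) :
    σ.pairForm (IN := IN) θ (fun y => k y * C.incl u) b x v =
      σ.pairForm (IN := IN) θ k b x v := by
  have hku : MDifferentiableAt IN IK (fun y => k y * C.incl u) x :=
    ((contMDiff_mul_right (I := IK) (n := ∞)).mdifferentiableAt (by simp)).comp x hk
  have h1 : (maurerCartan K IK).pullback (IN := IN) (fun y => k y * C.incl u) x v =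
      (maurerCartan K IK).pullback (IN := IN) k x v := by
    refine (maurerCartan_pullback_apply hku v).trans
      (Eq.trans ?_ (maurerCartan_pullback_apply hk v).symm)
    have e : (fun y => (k x * C.incl u)⁻¹ * (k y * C.incl u)) = fun y => (k x)⁻¹ * k y := by
      ext y
      rw [← C.central, ← C.central]
      group
    exact congrArg (fun f : N → K => (mfderiv IN IK f x : EN →L[ℝ] EK) v) e
  have e2 : (fun y => C.quot (k y * C.incl u)) = fun y => C.quot (k y) := by
    ext y; rw [map_mul, C.quot_incl, mul_one]
  have e3 : lieAd IK (k x * C.incl u)⁻¹ = lieAd IK (k x)⁻¹ := by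
    rw [← C.liftAd_quot, ← C.liftAd_quot, map_inv, map_inv, map_mul, C.quot_incl, mul_one]
  rw [σ.pairForm_apply, σ.pairForm_apply, h1, e2, e3, map_mul, C.quot_incl, mul_one]

variable [LieGroup IG ∞ G]

/-- The one-form `k^* ν_σ + Z_σ(q(k)⁻¹, b^* θ)` takes values in the kernel of `Lie K → Lie G`. -/
theorem CentralExtension.Split.lieQuot_pairForm (σ : C.Split) (θ : LieForm IB B IG G)
    {k : N → K} (b : N → B) {x : N} (hk : MDifferentiableAt IN IK k x)
    (v : TangentSpace IN x) : C.lieQuot (σ.pairForm (IN := IN) θ k b x v) = 0 := by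
  -- The contributions of ν_σ and Z_σ vanish separately under q_*.
  rw [σ.pairForm_apply, map_add, map_sub, map_sub, σ.lieQuot_comp, σ.lieQuot_comp]
  have h1 : C.lieQuot ((maurerCartan K IK).pullback (IN := IN) k x v) = _ :=
    lieMap_maurerCartan_pullback C.smooth_quot hk v
  have h2 : C.lieQuot (lieAd IK (k x)⁻¹ (σ.toCLM (θ.pullback (IN := IN) b x v))) = _ :=
    lieMap_lieAd C.smooth_quot (k x)⁻¹ _
  have h3 := σ.lieQuot_comp (θ.pullback (IN := IN) b x v)
  unfold CentralExtension.lieQuot at h3 h1 h2 ⊢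
  rw [h1, h2, h3, map_inv, sub_self, sub_self, add_zero]

variable [IsManifold IB ∞ B]

theorem CentralExtension.Split.pairForm_isSmooth [IsManifold IN ∞ N] (σ : C.Split)
    {θ : LieForm IB B IG G} (hθ : θ.IsSmooth) {k : N → K} {b : N → B}
    (hk : ContMDiff IN IK ∞ k) (hb : ContMDiff IN IB ∞ b) :
    (σ.pairForm (IN := IN) θ k b).IsSmooth := by
  have hb' := hθ.pullback hb
  have hq := C.smooth_quot.comp hk
  exact ((maurerCartan_isSmooth.pullback hk).sub
    ((maurerCartan_isSmooth.pullback hq).clm_comp σ.toCLM)).add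
    (((hb'.clm_comp σ.toCLM).lieAd_comp hk.inv).sub
      ((hb'.lieAd_comp hq.inv).clm_comp σ.toCLM))

/-- The one-form `k^* ν_σ + Z_σ(q(k)⁻¹, b^* θ)` is additive under products. -/
theorem CentralExtension.Split.pairForm_mul (σ : C.Split) {act : B → G → B}
    {θ : LieForm IB B IG G} (hθ : IsPrincipalConnection act θ)
    (hact : ContMDiff (IB.prod IG) IB ∞ (fun x : B × G => act x.1 x.2))
    (act_mul : ∀ p g h, act p (g * h) = act (act p g) h) (act_one : ∀ p, act p 1 = p)
    {k l : N → K} {b c : N → B} {x : N} (hk : MDifferentiableAt IN IK k x)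
    (hl : MDifferentiableAt IN IK l x) (hb : MDifferentiableAt IN IB b x)
    (hc : ∀ y, c y = act (b y) (C.quot (k y))) (v : TangentSpace IN x) :
    σ.pairForm (IN := IN) θ (fun y => k y * l y) b x v =
      σ.pairForm (IN := IN) θ k b x v + σ.pairForm (IN := IN) θ l c x v := by
  obtain ⟨r, -, hr⟩ := C.exists_lieIncl_retraction
  have hq : MDifferentiable IK IG C.quot := C.smooth_quot.mdifferentiable (by simp)
  have hqk : MDifferentiableAt IN IG (fun y => C.quot (k y)) x := (hq (k x)).comp x hk
  have hql : MDifferentiableAt IN IG (fun y => C.quot (l y)) x := (hq (l x)).comp x hl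
  -- The only use of centrality: the value lies in the kernel of q_*, hence in Lie 𝕋, where Ad is
  -- trivial.
  have hcen : lieAd IK (l x)⁻¹ (σ.pairForm (IN := IN) θ k b x v) =
      σ.pairForm (IN := IN) θ k b x v := by
    rw [← hr _ (σ.lieQuot_pairForm θ b hk v), C.lieAd_lieIncl]
  obtain rfl : c = fun y => act (b y) (C.quot (k y)) := funext hc
  have hθc := hθ.pullback_act hact act_mul act_one hb hqk v
  have hmk := maurerCartan_pullback_mul hk hl v
  have hmq := maurerCartan_pullback_mul hqk hql v
  simp only [σ.pairForm_apply, map_add, map_sub] at hcen ⊢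
  simp only [map_mul, mul_inv_rev, lieAd_mul] at hθc hmk hmq hcen ⊢
  rw [hθc, hmk, hmq]
  simp only [map_add]
  -- After expansion, the defect of additivity is Ad_{l⁻¹} form(k, b) - form(k, b), term by term.
  rw [← sub_eq_zero] at hcen ⊢
  refine Eq.trans ?_ hcen
  abel

/-! ### The connection form on `J_B` as the form of a pair -/

namespace LiftingGerbe

variable {P : PrincipalBundle IG IB IX G B X}

theorem contMDiff_lift : ContMDiff (IB.prod IK) IK ∞ (lift (C := C) (P := P)) :=
  (contMDiff_iff.1 contMDiff_id).2

theorem contMDiff_proj :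
    ContMDiff (IB.prod IK) (IB.prod IG) ∞ (proj (C := C) (P := P)) :=
  (contMDiff_iff.1 contMDiff_id).1

theorem _root_.PrincipalBundle.FibreSquare.contMDiff_fst :
    ContMDiff (IB.prod IG) IB ∞ (PrincipalBundle.FibreSquare.fst (P := P)) :=
  (PrincipalBundle.FibreSquare.contMDiff_iff.1 contMDiff_id).1

theorem contMDiff_base :
    ContMDiff (IB.prod IK) IB ∞ (fun j : LiftingGerbe C P => j.proj.fst) :=
  PrincipalBundle.FibreSquare.contMDiff_fst.comp contMDiff_proj

/-- The cocycle acts through a chosen lift of ζ⁻¹, but any lift gives the same operator, and at j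
the inverse of the Γ̂-component is one. The rest is functoriality of pull-back. -/
theorem connectionForm_eq_pairForm (σ : C.Split) (θ : LieForm IB B IG G) (j : LiftingGerbe C P) :
    connectionForm σ θ j =
      σ.pairForm (IN := IB.prod IK) θ lift (fun j : LiftingGerbe C P => j.proj.fst) j := by
  have hl : MDifferentiable (IB.prod IK) IK (lift (C := C) (P := P)) :=
    contMDiff_lift.mdifferentiable (by simp)
  have hp : MDifferentiable (IB.prod IK) (IB.prod IG) (proj (C := C) (P := P)) :=
    contMDiff_proj.mdifferentiable (by simp)
  have hf : MDifferentiable (IB.prod IG) IB (PrincipalBundle.FibreSquare.fst (P := P)) :=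
    PrincipalBundle.FibreSquare.contMDiff_fst.mdifferentiable (by simp)
  have hq : MDifferentiable IK IG C.quot := C.smooth_quot.mdifferentiable (by simp)
  have h1 := LieForm.pullback_pullback (maurerCartan G IG) (hq (lift j)) (hl j)
  have h2 := LieForm.pullback_pullback θ (hf (proj j)) (hp j)
  ext v
  have h1 := DFunLike.congr_fun h1 v
  have h2 := DFunLike.congr_fun h2 v
  have h3 : C.liftAd (j.proj.zeta)⁻¹ = lieAd IK j.lift⁻¹ := by
    rw [zeta_proj, ← map_inv, C.liftAd_quot]
  have h4 : connectionForm σ θ j v =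
      ((maurerCartan K IK).pullback (IN := IB.prod IK) lift j v -
        σ.toCLM (((maurerCartan G IG).pullback (IN := IK) C.quot).pullback
          (IN := IB.prod IK) lift j v)) +
      (C.liftAd (j.proj.zeta)⁻¹ (σ.toCLM ((θ.pullback (IN := IB.prod IG)
          PrincipalBundle.FibreSquare.fst).pullback (IN := IB.prod IK) proj j v)) -
        σ.toCLM (lieAd IG (j.proj.zeta)⁻¹ ((θ.pullback (IN := IB.prod IG)
          PrincipalBundle.FibreSquare.fst).pullback (IN := IB.prod IK) proj j v))) := rfl
  rw [h4, σ.pairForm_apply, h1, h2, h3, zeta_proj]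

/-- Pull-back only composes the two maps of the pair with f. Orbits, translations and composable
pairs can thus be treated without computing derivatives of maps into `J_B`. -/
theorem connectionForm_pullback (σ : C.Split) (θ : LieForm IB B IG G) {f : N → LiftingGerbe C P}
    {x : N} (hf : MDifferentiableAt IN (IB.prod IK) f x) :
    (connectionForm σ θ).pullback (IN := IN) f x =
      σ.pairForm (IN := IN) θ (fun y => (f y).lift) (fun y => (f y).proj.fst) x := by
  have hl : MDifferentiable (IB.prod IK) IK (lift (C := C) (P := P)) :=
    contMDiff_lift.mdifferentiable (by simp)
  have hb : MDifferentiable (IB.prod IK) IB (fun j : LiftingGerbe C P => j.proj.fst) :=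
    contMDiff_base.mdifferentiable (by simp)
  have hq : MDifferentiable IK IG C.quot := C.smooth_quot.mdifferentiable (by simp)
  have hql : MDifferentiable (IB.prod IK) IG (fun j : LiftingGerbe C P => C.quot j.lift) :=
    hq.comp hl
  ext v
  have h1 := DFunLike.congr_fun (LieForm.pullback_pullback (maurerCartan G IG) (hql (f x)) hf) v
  have h2 := DFunLike.congr_fun (LieForm.pullback_pullback (maurerCartan K IK) (hl (f x)) hf) v
  have h3 := DFunLike.congr_fun (LieForm.pullback_pullback θ (hb (f x)) hf) v
  rw [σ.pairForm_apply, ← h1, ← h2, ← h3]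
  exact DFunLike.congr_fun (connectionForm_eq_pairForm σ θ (f x)) (mfderiv IN (IB.prod IK) f x v)

end LiftingGerbe

end ConnectionForm

/-! ### The lifting bundle gerbe and its connection -/

section BundleGerbe

variable {EK HK K EG HG G EB HB B EX HX X EN HN N : Type*}
  [NormedAddCommGroup EK] [NormedSpace ℝ EK] [TopologicalSpace HK]
  [TopologicalSpace K] [ChartedSpace HK K] [Group K]
  [NormedAddCommGroup EG] [NormedSpace ℝ EG] [TopologicalSpace HG]
  [TopologicalSpace G] [ChartedSpace HG G] [Group G]
  [NormedAddCommGroup EB] [NormedSpace ℝ EB] [TopologicalSpace HB]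
  [TopologicalSpace B] [ChartedSpace HB B]
  [NormedAddCommGroup EX] [NormedSpace ℝ EX] [TopologicalSpace HX]
  [TopologicalSpace X] [ChartedSpace HX X]
  [NormedAddCommGroup EN] [NormedSpace ℝ EN] [TopologicalSpace HN]
  [TopologicalSpace N] [ChartedSpace HN N]
  {IK : ModelWithCorners ℝ EK HK} {IG : ModelWithCorners ℝ EG HG}
  {IB : ModelWithCorners ℝ EB HB} {IX : ModelWithCorners ℝ EX HX}
  {IN : ModelWithCorners ℝ EN HN}

/-- A principal bundle has local smooth sections. -/
theorem IsPrincipalBundle.exists_local_section {proj : B → X} {act : B → G → B}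
    (h : IsPrincipalBundle IG IB IX proj act) (x : X) :
    ∃ U : Set X, IsOpen U ∧ x ∈ U ∧ ∃ s : X → B,
      ContMDiffOn IX IB ∞ s U ∧ ∀ y ∈ U, proj (s y) = y := by
  obtain ⟨e, he, -, hs', -⟩ := h.locally_trivial x
  refine ⟨e.baseSet, e.open_baseSet, he,
    fun y => e.toOpenPartialHomeomorph.symm (y, (1 : G)), ?_, fun y hy => ?_⟩
  · exact hs'.comp (contMDiffOn_id.prodMk contMDiffOn_const) fun y hy => e.mem_target.2 hy
  · exact e.proj_symm_apply (e.mem_target.2 hy)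

variable {C : CentralExtension IK IG K G} {P : PrincipalBundle IG IB IX G B X}

theorem LiftingGerbe.ext {i j : LiftingGerbe C P} (hf : i.proj.fst = j.proj.fst)
    (hs : i.proj.snd = j.proj.snd) (hl : i.lift = j.lift) : i = j :=
  Subtype.ext (Prod.ext (Subtype.ext (Prod.ext hf hs)) hl)

variable [LieGroup IG ∞ G]

namespace PrincipalBundle.FibreSquare

variable [IsManifold IB ∞ B]

theorem contMDiff_zeta : ContMDiff (IB.prod IG) IG ∞ (zeta (P := P)) :=
  (transport_contMDiff (IB.prod IG) (homeo P)).1.snd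

end PrincipalBundle.FibreSquare

variable [LieGroup IK ∞ K] [IsManifold IB ∞ B]

namespace LiftingGerbe

theorem contMDiffOn_mk {f : N → LiftingGerbe C P} {t : Set N}
    (hb : ContMDiffOn IN IB ∞ (fun x => (f x).proj.fst) t)
    (hk : ContMDiffOn IN IK ∞ (fun x => (f x).lift) t) :
    ContMDiffOn IN (IB.prod IK) ∞ f t :=
  ((transport_contMDiff (IB.prod IK) (homeo C P)).2.comp_contMDiffOn (hb.prodMk hk)).congr
    fun x _ => ((homeo C P).symm_apply_apply (f x)).symm

theorem smooth_act : ContMDiff ((IB.prod IK).prod (𝓡 1)) (IB.prod IK) ∞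
    (fun x : LiftingGerbe C P × Circle => x.1.act x.2) := by
  have h : ContMDiff ((IB.prod IK).prod (𝓡 1)) (IB.prod IK) ∞
      (Prod.fst : LiftingGerbe C P × Circle → LiftingGerbe C P) := contMDiff_fst
  have hp := contMDiff_proj.comp h
  have hl := (contMDiff_lift.comp h).mul (C.smooth_incl.comp contMDiff_snd)
  exact contMDiff_iff.2 ⟨hp, hl⟩

/-- The trivialization of `ζ^* K` induced by one of `K`. -/
def trivialization (e : Trivialization Circle C.quot) (k₀ : G → K) (hk₀ : ∀ g, C.quot (k₀ g) = g)
    (hs : ContMDiffOn IK (IG.prod (𝓡 1)) ∞ e e.source)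
    (hk₀s : ContMDiffOn IG IK ∞ k₀ e.baseSet)
    (hek₀ : ∀ g ∈ e.baseSet, (e (k₀ g)).2 = 1)
    (heq : ∀ p ∈ e.source, ∀ u, e (p * C.incl u) = ((e p).1, (e p).2 * u)) :
    Trivialization Circle (proj (C := C) (P := P)) where
  toFun j := (j.proj, (e j.lift).2)
  invFun z := ⟨(z.1, k₀ z.1.zeta * C.incl z.2), by rw [map_mul, hk₀, C.quot_incl, mul_one]⟩
  source := {j | j.proj.zeta ∈ e.baseSet}
  target := {y : P.FibreSquare | y.zeta ∈ e.baseSet} ×ˢ Set.univ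
  map_source' j hj := ⟨hj, trivial⟩
  map_target' z hz := hz.1
  left_inv' j hj := by
    refine Subtype.ext (Prod.ext rfl ?_)
    change k₀ j.proj.zeta * C.incl (e j.lift).2 = j.lift
    have hj1 : j.proj.zeta ∈ e.baseSet := hj
    have hk : k₀ j.proj.zeta ∈ e.source := e.mem_source.2 (by rwa [hk₀])
    have hl : j.lift ∈ e.source := e.mem_source.2 (by rwa [← zeta_proj])
    refine e.injOn (e.mem_source.2 (by rwa [map_mul, hk₀, C.quot_incl, mul_one])) hl ?_
    change e (k₀ j.proj.zeta * C.incl (e j.lift).2) = e j.lift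
    -- Since k₀ has fibre coordinate 1, multiplying it by the image of a circle element u gives
    -- fibre coordinate u.
    rw [heq _ hk, hek₀ _ hj1, one_mul, e.coe_fst hk, hk₀, zeta_proj, ← e.coe_fst hl]
  right_inv' z hz := by
    have hz1 : z.1.zeta ∈ e.baseSet := hz.1
    refine Prod.ext rfl ?_
    change (e (k₀ z.1.zeta * C.incl z.2)).2 = z.2
    rw [heq _ (e.mem_source.2 (by rwa [hk₀])), hek₀ _ hz1, one_mul]
  open_source := e.open_baseSet.preimage
    ((PrincipalBundle.FibreSquare.continuous_zeta P).comp continuous_proj)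
  open_target := (e.open_baseSet.preimage
    (PrincipalBundle.FibreSquare.continuous_zeta P)).prod isOpen_univ
  continuousOn_toFun := by
    refine continuous_proj.continuousOn.prodMk (continuous_snd.comp_continuousOn
      (hs.continuousOn.comp continuous_lift.continuousOn fun j hj => e.mem_source.2 ?_))
    rw [← zeta_proj]
    exact hj
  continuousOn_invFun := by
    have := topologicalGroup_of_lieGroup (G := K) IK ∞
    refine Topology.IsInducing.subtypeVal.continuousOn_iff.2 ?_
    refine continuous_fst.continuousOn.prodMk (ContinuousOn.mul ?_
      (C.smooth_incl.continuous.comp continuous_snd).continuousOn)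
    exact hk₀s.continuousOn.comp ((PrincipalBundle.FibreSquare.continuous_zeta P).comp
      continuous_fst).continuousOn fun z hz => hz.1
  baseSet := {y : P.FibreSquare | y.zeta ∈ e.baseSet}
  open_baseSet := e.open_baseSet.preimage (PrincipalBundle.FibreSquare.continuous_zeta P)
  source_eq := rfl
  target_eq := rfl
  proj_toFun _ _ := rfl

theorem isPrincipalBundle :
    IsPrincipalBundle (𝓡 1) (IB.prod IK) (IB.prod IG) (proj (C := C) (P := P)) act where
  smooth_proj := contMDiff_proj
  smooth_act := smooth_act
  act_one j := ext rfl rfl (by change j.lift * C.incl 1 = j.lift; rw [map_one, mul_one])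
  act_mul j u w := ext rfl rfl (by
    change j.lift * C.incl (u * w) = j.lift * C.incl u * C.incl w
    rw [map_mul, _root_.mul_assoc])
  proj_act _ _ := rfl
  locally_trivial y := by
    classical
    obtain ⟨e, he, hs, hs', heq⟩ := C.isPrincipalBundle.locally_trivial y.zeta
    -- The inverse of the trivialization must be defined everywhere with values in the pull-back, so
    -- k₀ has to lift every g. Off the base set an arbitrary preimage serves; smoothness is needed
    -- only on it.
    let k₀ : G → K := fun g => if g ∈ e.baseSet then
      e.toOpenPartialHomeomorph.symm (g, (1 : Circle)) else Function.surjInv C.quot_surjective g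
    have hk₀b : ∀ g ∈ e.baseSet, k₀ g = e.toOpenPartialHomeomorph.symm (g, (1 : Circle)) :=
      fun g hg => if_pos hg
    have hk₀ : ∀ g, C.quot (k₀ g) = g := fun g => by
      by_cases hg : g ∈ e.baseSet
      · rw [hk₀b g hg]
        exact e.proj_symm_apply (e.mem_target.2 hg)
      · simp only [k₀, if_neg hg]
        exact Function.surjInv_eq C.quot_surjective g
    have hk₀s : ContMDiffOn IG IK ∞ k₀ e.baseSet :=
      (hs'.comp (contMDiffOn_id.prodMk contMDiffOn_const)
        fun g hg => e.mem_target.2 hg).congr hk₀b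
    have hek₀ : ∀ g ∈ e.baseSet, (e (k₀ g)).2 = 1 := fun g hg => by
      rw [hk₀b g hg]
      exact congrArg Prod.snd (e.toOpenPartialHomeomorph.right_inv (e.mem_target.2 hg))
    have hmem : ∀ j : LiftingGerbe C P, j.proj.zeta ∈ e.baseSet → j.lift ∈ e.source :=
      fun j hj => e.mem_source.2 (by rwa [← zeta_proj])
    refine ⟨trivialization e k₀ hk₀ hs hk₀s hek₀ heq, he, ?_, ?_, ?_⟩
    · exact contMDiff_proj.contMDiffOn.prodMk
        (contMDiff_snd.comp_contMDiffOn (hs.comp contMDiff_lift.contMDiffOn hmem))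
    · refine contMDiffOn_mk (PrincipalBundle.FibreSquare.contMDiff_fst.comp
        contMDiff_fst).contMDiffOn (ContMDiffOn.mul ?_
          (C.smooth_incl.comp contMDiff_snd).contMDiffOn)
      exact hk₀s.comp (PrincipalBundle.FibreSquare.contMDiff_zeta.comp contMDiff_fst).contMDiffOn
        fun z hz => hz.1
    · intro j hj u
      refine Prod.ext rfl ?_
      change (e (j.lift * C.incl u)).2 = (e j.lift).2 * u
      rw [heq _ (hmem j hj)]

theorem contMDiff_product :
    ContMDiff ((IB.prod IK).prod IK) (IB.prod IK) ∞ (product C P) := by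
  obtain ⟨h1, h2⟩ := ComposablePairs.contMDiff_iff.1
    (contMDiff_id (I := (IB.prod IK).prod IK) (M := ComposablePairs C P) (n := ∞))
  have hb := contMDiff_base.comp h1
  have hs := (PrincipalBundle.FibreSquare.contMDiff_iff.1 (contMDiff_proj.comp h2)).2
  exact contMDiff_iff.2 ⟨PrincipalBundle.FibreSquare.contMDiff_iff.2 ⟨hb, hs⟩,
    ((contMDiff_lift.comp h1).mul (contMDiff_lift.comp h2) :)⟩

theorem isBundleGerbe : IsBundleGerbe C P where
  locally_split := P.isPrincipalBundle.exists_local_section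
  isPrincipalBundle := isPrincipalBundle
  smooth_product := contMDiff_product
  fst_mul _ _ _ := rfl
  snd_mul _ _ _ := rfl
  act_mul i j _ u := ext rfl rfl (by
    change i.lift * C.incl u * j.lift = i.lift * j.lift * C.incl u
    rw [_root_.mul_assoc, C.central, _root_.mul_assoc])
  mul_act i j _ u := ext rfl rfl (_root_.mul_assoc i.lift j.lift (C.incl u)).symm
  mul_assoc i j k _ _ := ext rfl rfl (_root_.mul_assoc i.lift j.lift k.lift)

/-- The connection form takes values in `iℝ ⊆ Lie K`, so it comes from a unique form with values
in `Lie 𝕋`. -/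
theorem existsUnique_connection (σ : C.Split) (θ : LieForm IB B IG G) :
    ∃! nabla : LieForm (IB.prod IK) (LiftingGerbe C P) (𝓡 1) Circle,
      ∀ j, C.lieIncl.comp (nabla j) = connectionForm σ θ j := by
  obtain ⟨l, -, hl⟩ := C.exists_lieIncl_retraction
  -- The retraction onto Lie 𝕋 recovers the form because its values already lie in the kernel of
  -- q_*.
  refine ⟨fun j => l.comp (connectionForm σ θ j), fun j => ?_, fun nabla h => ?_⟩
  · ext v
    refine Eq.trans ?_ (DFunLike.congr_fun (connectionForm_eq_pairForm σ θ j) v).symm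
    change C.lieIncl (l (connectionForm σ θ j v)) = _
    rw [connectionForm_eq_pairForm]
    exact hl _ (σ.lieQuot_pairForm θ _ (contMDiff_lift.mdifferentiableAt (by simp)) v)
  · ext j v : 2
    refine C.lieIncl_injective ?_
    have h1 := DFunLike.congr_fun (h j) v
    refine h1.trans ?_
    rw [connectionForm_eq_pairForm]
    exact (hl _ (σ.lieQuot_pairForm θ _ (contMDiff_lift.mdifferentiableAt (by simp)) v)).symm

/-- Together with `lieIncl_injective`, this reduces the vertical, equivariance and compatibility
conditions to identities for `pairForm`. -/
theorem lieIncl_pullback (σ : C.Split) {θ : LieForm IB B IG G}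
    {nabla : LieForm (IB.prod IK) (LiftingGerbe C P) (𝓡 1) Circle}
    (h : ∀ j, C.lieIncl.comp (nabla j) = connectionForm σ θ j) {f : N → LiftingGerbe C P} {x : N}
    (hf : MDifferentiableAt IN (IB.prod IK) f x) (v : TangentSpace IN x) :
    C.lieIncl (nabla.pullback (IN := IN) f x v) =
      σ.pairForm (IN := IN) θ (fun y => (f y).lift) (fun y => (f y).proj.fst) x v :=
  (DFunLike.congr_fun (h (f x)) (mfderiv IN (IB.prod IK) f x v)).trans
    (DFunLike.congr_fun (connectionForm_pullback σ θ hf) v)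

theorem isPrincipalConnection (σ : C.Split) {θ : LieForm IB B IG G} (hθ : θ.IsSmooth)
    {nabla : LieForm (IB.prod IK) (LiftingGerbe C P) (𝓡 1) Circle}
    (h : ∀ j, C.lieIncl.comp (nabla j) = connectionForm σ θ j) :
    IsPrincipalConnection act nabla where
  smooth := by
    obtain ⟨l, hl, -⟩ := C.exists_lieIncl_retraction
    -- Smoothness descends from Lie Γ̂ to Lie 𝕋 by composing with the continuous retraction.
    have e : nabla = fun j => l.comp
        (σ.pairForm (IN := IB.prod IK) θ lift (fun j : LiftingGerbe C P => j.proj.fst) j) := by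
      ext j v : 2
      refine (hl _).symm.trans (congrArg l ?_)
      rw [← connectionForm_eq_pairForm]
      exact DFunLike.congr_fun (h j) v
    rw [e]
    exact (σ.pairForm_isSmooth hθ contMDiff_lift contMDiff_base).clm_comp l
  vertical p A := by
    refine C.lieIncl_injective ?_
    have hf : ContMDiff (𝓡 1) (IB.prod IK) ∞ (fun u : Circle => p.act u) :=
      smooth_act.comp (contMDiff_const.prodMk contMDiff_id)
    refine (lieIncl_pullback σ h (hf.mdifferentiableAt (by simp)) A).trans ?_
    exact σ.pairForm_mul_incl_apply θ p.lift p.proj.fst A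
  equivariant p u v := by
    refine C.lieIncl_injective ?_
    have hf : ContMDiff (IB.prod IK) (IB.prod IK) ∞ (fun j : LiftingGerbe C P => j.act u) :=
      smooth_act.comp (contMDiff_id.prodMk contMDiff_const)
    refine (lieIncl_pullback σ h (hf.mdifferentiableAt (by simp)) v).trans ?_
    -- The circle is abelian, so equivariance is plain invariance.
    rw [lieAd_circle]
    refine Eq.trans ?_ (DFunLike.congr_fun (h p) v).symm
    rw [connectionForm_eq_pairForm]
    exact σ.pairForm_mul_incl θ u _ (contMDiff_lift.mdifferentiableAt (by simp)) v

theorem isBundleGerbeConnection (σ : C.Split) {θ : LieForm IB B IG G}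
    (hθ : IsPrincipalConnection P.act θ)
    {nabla : LieForm (IB.prod IK) (LiftingGerbe C P) (𝓡 1) Circle}
    (h : ∀ j, C.lieIncl.comp (nabla j) = connectionForm σ θ j) :
    IsBundleGerbeConnection nabla where
  isPrincipalConnection := isPrincipalConnection σ hθ.smooth h
  compatible x := by
    obtain ⟨h1, h2⟩ := ComposablePairs.contMDiff_iff.1
      (contMDiff_id (I := (IB.prod IK).prod IK) (M := ComposablePairs C P) (n := ∞))
    have hne : (∞ : WithTop ℕ∞) ≠ 0 := by simp
    have e1 := lieIncl_pullback σ h (h1.mdifferentiableAt hne (x := x))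
    have e2 := lieIncl_pullback σ h (h2.mdifferentiableAt hne (x := x))
    have e3 := lieIncl_pullback σ h ((contMDiff_product (C := C) (P := P)).mdifferentiableAt
      hne (x := x))
    ext v : 1
    refine C.lieIncl_injective ((map_add C.lieIncl _ _).trans ?_)
    refine (congrArg₂ (fun a b : GroupLieAlgebra IK K => a + b) (e1 v) (e2 v)).trans
      (Eq.trans ?_ (e3 v).symm)
    refine (σ.pairForm_mul hθ P.isPrincipalBundle.smooth_act P.isPrincipalBundle.act_mul
      P.isPrincipalBundle.act_one (contMDiff_lift.comp h1 |>.mdifferentiableAt hne)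
      (contMDiff_lift.comp h2 |>.mdifferentiableAt hne)
      (contMDiff_base.comp h1 |>.mdifferentiableAt hne) (fun y => ?_) v).symm
    -- The hypothesis c = b q(k) of additivity: the second factor starts at b₂ = b₁ ζ(b₁, b₂), where
    -- the first one ends.
    change y.snd.proj.fst = P.act y.fst.proj.fst (C.quot y.fst.lift)
    rw [← zeta_proj, PrincipalBundle.FibreSquare.act_zeta, y.snd_fst]

end LiftingGerbe

end BundleGerbe

end

/-- Let `(B, θ)` be a `Γ`-bundle with connection over `X`, `Γ̂` a central extension of `Γ` by `𝕋`, and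
`σ` a split of the Lie algebra. The one-form `ζ^* ν_σ + ρ^* Z_σ(ζ⁻¹, π₁^* θ)` on `J_B = ζ^* Γ̂` takes
values in `iℝ = Lie 𝕋`, and it is a bundle gerbe connection on the lifting bundle gerbe
`(J_B, B)`. -/
theorem mainTheorem2
    {EK : Type*} [NormedAddCommGroup EK] [NormedSpace ℝ EK] {HK : Type*} [TopologicalSpace HK]
    {IK : ModelWithCorners ℝ EK HK}
    {EG : Type*} [NormedAddCommGroup EG] [NormedSpace ℝ EG] {HG : Type*} [TopologicalSpace HG]
    {IG : ModelWithCorners ℝ EG HG}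
    {EB : Type*} [NormedAddCommGroup EB] [NormedSpace ℝ EB] {HB : Type*} [TopologicalSpace HB]
    {IB : ModelWithCorners ℝ EB HB}
    {EX : Type*} [NormedAddCommGroup EX] [NormedSpace ℝ EX] {HX : Type*} [TopologicalSpace HX]
    {IX : ModelWithCorners ℝ EX HX}
    -- the Lie groups `Γ̂` and `Γ`
    {Γ' : Type*} [TopologicalSpace Γ'] [ChartedSpace HK Γ'] [Group Γ'] [LieGroup IK ∞ Γ']
    {Γ : Type*} [TopologicalSpace Γ] [ChartedSpace HG Γ] [Group Γ] [LieGroup IG ∞ Γ]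
    -- the total space and the base of the bundle
    {B : Type*} [TopologicalSpace B] [ChartedSpace HB B] [IsManifold IB ∞ B]
    {X : Type*} [TopologicalSpace X] [ChartedSpace HX X] [IsManifold IX ∞ X]
    (C : CentralExtension IK IG Γ' Γ) (P : PrincipalBundle IG IB IX Γ B X)
    (θ : LieForm IB B IG Γ) (hθ : IsPrincipalConnection P.act θ) (σ : C.Split) :
    LiftingGerbe.IsBundleGerbe C P ∧
    (∃! nabla : LieForm (IB.prod IK) (LiftingGerbe C P) (𝓡 1) Circle,
      ∀ j, C.lieIncl.comp (nabla j) = LiftingGerbe.connectionForm σ θ j) ∧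
    ∀ nabla : LieForm (IB.prod IK) (LiftingGerbe C P) (𝓡 1) Circle,
      (∀ j, C.lieIncl.comp (nabla j) = LiftingGerbe.connectionForm σ θ j) →
      LiftingGerbe.IsBundleGerbeConnection nabla := by
  exact ⟨LiftingGerbe.isBundleGerbe, LiftingGerbe.existsUnique_connection σ θ,
    fun _ h => LiftingGerbe.isBundleGerbeConnection σ hθ h⟩
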